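/- Let $\mathcal G=(\mathcal V,\mathcal E)$, $\mathcal E\subseteq\mathcal V\times\mathcal V$, be a finite weakly connected digraph that is not strongly connected. Its nodes are agents with distinct, linearly ordered identifiers. A strongly connected component (SCC) is an s-SCC (source) if some edge leaves it and no edge enters it, and a t-SCC (target) if some edge enters it and no edge leaves it. Let $\alpha$ and $\beta$ be the numbers of s-SCCs and t-SCCs of $\mathcal G$. Algorithm 1 is the following synchronous distributed algorithm, run by all agents in rounds; $\mathcal E^*$ is the set of added edges, initially empty, and $N^+_u,N^-_u$ are the sets of out- and in-neighbours of $u$ in the current digraph $(\mathcal V,\mathcal E\cup\mathcal E^*)$. In each round: * Phase 1 (all agents $u$). Put $x_u^{(0)}=\emptyset$, $x_u^{(1)}=\{(u,v):v\in N^+_u\}$. For $k=1,2,\dots$ the agent $u$ sends the new edges $\nu_u^{(k)}=x_u^{(k)}\setminus x_u^{(k-1)}$ to all its out-neighbours, receives $\nu_v^{(k)}$ from all its in-neighbours $v$ and puts $x_u^{(k+1)}=x_u^{(k)}\cup\bigcup_{v\in N^-_u}\nu_v^{(k)}$, until $x_u^{(k+1)}=x_u^{(k)}$. It then computes, by Tarjan's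 algorithm, the SCCs of the digraph formed by its known edges, and classifies its own SCC $S$ by whether known edges enter or leave $S$. If none enters and none leaves, $u$ exits. Otherwise, if none enters and $u=\min S$, the agent is a source representative; if none leaves and $u=\min S$, it is a target representative; all other agents wait for the next round. * Phase 2 (target representatives $t$). Let $R_t$ be the set of the smallest agents of the SCCs known to $t$ that no known edge enters. The agent $t$ sends $R_t$ to every $s\in R_t$. * Phase 3 (source representatives $s$). Let $P_s$ be the set of all $t$ from which $s$ received a message in Phase 2. If $|R_t|>1$ for some $t\in P_s$, then $s$ selects one such $t$ (by linear search, in an arbitrary order) and sends $P_s$ to it; otherwise all edges $(t,s)$, $t\in P_s$, are added to $\mathcal E^*$. * Phase 4 (target representatives $t$). Let $Q_t$ be the set of all $s$ from which $t$ received a message in Phase 3. If $|P_s|>1$ for some $s\in Q_t$, then one such $s$ is selected (by linear search, in an arbitrary order) and $(t,s)$ is added to $\mathcal E^*$; otherwise all edges $(t,s)$, $s\in Q_t$, are added to $\mathcal E^*$. The time of an agent is the number of elementary operations that it performs itself, in all rounds together: comparisons and accesses to variables, finite sets and dictionaries cost one unit each, and a message with $m$ items (identifiers or edges) costs $m+1$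 units for the sender (per recipient) and for the receiver. **Theorem.** Whatever selections are made, all agents exit after finitely many synchronous steps, and the total time of every agent $u\in\mathcal V$ is $$\mathcal O\big(|\mathcal V|\,|\mathcal E|\,\min\{\alpha,\beta\}\big),$$ where the implied constant is absolute (it does not depend on $\mathcal G$, on $u$ or on the selections). -/

import Mathlib

/-! ## Digraphs

A digraph on the agents `V` is given by its finite set of edges `E ⊆ V × V`. The linear order on `V`
is the order of the (unique) identifiers of the agents. -/

namespace DigraphAug

/-- There is a path from `u` to `v` (the one-vertex path is allowed). -/
def Reach {V : Type} (E : Finset (V × V)) (u v : V) : Prop :=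
  Relation.ReflTransGen (fun a b => (a, b) ∈ E) u v

def StronglyConnected {V : Type} (E : Finset (V × V)) : Prop :=
  ∀ u v : V, Reach E u v

/-- Any two nodes are joined by a path if the directions of the edges are ignored. -/
def WeaklyConnected {V : Type} (E : Finset (V × V)) : Prop :=
  ∀ u v : V, Relation.ReflTransGen (fun a b => (a, b) ∈ E ∨ (b, a) ∈ E) u v

/-- A strongly connected component: a maximal set of pairwise mutually reachable nodes. -/
def IsSCC {V : Type} (E : Finset (V × V)) (S : Set V) : Prop :=
  Maximal (fun S : Set V => ∀ u ∈ S, ∀ v ∈ S, Reach E u v ∧ Reach E v u) S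

/-- Some edge starts in `S` and ends outside `S`. -/
def HasOut {V : Type} (E : Finset (V × V)) (S : Set V) : Prop :=
  ∃ e ∈ E, e.1 ∈ S ∧ e.2 ∉ S

/-- Some edge starts outside `S` and ends in `S`. -/
def HasIn {V : Type} (E : Finset (V × V)) (S : Set V) : Prop :=
  ∃ e ∈ E, e.1 ∉ S ∧ e.2 ∈ S

def IsSourceSCC {V : Type} (E : Finset (V × V)) (S : Set V) : Prop :=
  IsSCC E S ∧ HasOut E S ∧ ¬ HasIn E S

def IsTargetSCC {V : Type} (E : Finset (V × V)) (S : Set V) : Prop :=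
  IsSCC E S ∧ ¬ HasOut E S ∧ HasIn E S

/-- The number `α` of source SCCs. -/
noncomputable def numSource {V : Type} (E : Finset (V × V)) : ℕ :=
  {S : Set V | IsSourceSCC E S}.ncard

/-- The number `β` of target SCCs. -/
noncomputable def numTarget {V : Type} (E : Finset (V × V)) : ℕ :=
  {S : Set V | IsTargetSCC E S}.ncard

/-! ## Programs with a step count

The cost model is the usual unit-cost one: a constant number of comparisons and of reads and writes of
variables, of finite sets (membership, insertion, size) and of dictionaries (functions changed by
`Function.update`) is one step. Going through a list, or through a finite set in some fixed order, costs
one step per element in addition to the work done for the element; the combinator `loop` charges this.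
Sending or receiving a message costs one step plus one step for every item (identifier or edge) in it. -/

/-- A result together with the number of steps spent on it. -/
structure Timed (α : Type) where
  val : α
  steps : ℕ

namespace Timed

instance : Monad Timed where
  pure a := ⟨a, 0⟩
  bind x f := ⟨(f x.val).val, x.steps + (f x.val).steps⟩

/-- Spend `n` steps. -/
def tick (n : ℕ) : Timed Unit := ⟨(), n⟩

/-- `for a in l do b := f b a`: one step per pass, and one for leaving the loop. -/
def loop {α β : Type} (f : β → α → Timed β) : β → List α → Timed β
  | b, [] => do
    tick 1
    pure b
  | b, a :: l => do
    tick 1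
    let b' ← f b a
    loop f b' l

/-- Linear search for the first element of the list that satisfies `p`. -/
def search {α : Type} (p : α → Bool) : List α → Timed (Option α)
  | [] => do
    tick 1
    pure none
  | a :: l => do
    tick 1
    if p a then pure (some a) else search p l

end Timed

open Timed

/-! ## Tarjan's algorithm -/

structure TarjanState (V : Type) where
  /-- the next discovery number -/
  next : ℕ
  /-- discovery numbers of the nodes visited so far -/
  num : V → Option ℕ
  /-- visited nodes whose component is not complete yet -/
  stack : List V
  /-- label of the component of a node, once that component is complete: the discovery number of its
  root. A visited node is on the stack as long as it has no label. -/
  comp : V → Option ℕ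
  /-- the completed components -/
  sccs : List (List V)

def TarjanState.empty (V : Type) : TarjanState V :=
  ⟨0, fun _ => none, [], fun _ => none, []⟩

/-- Pop the stack down to and including `v`; returns the popped nodes and the remaining stack. -/
def popUntil {V : Type} [DecidableEq V] (v : V) : List V → Timed (List V × List V)
  | [] => do
    tick 1
    pure ([], [])
  | w :: l => do
    tick 1
    if w = v then pure ([w], l)
    else do
      let p ← popUntil v l
      pure (w :: p.1, p.2)

/-- The recursive procedure of Tarjan's algorithm at the unvisited node `v`; besides the new state it
returns the lowlink of `v`. The first argument bounds the depth of the recursion. -/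
def visit {V : Type} [DecidableEq V] (adj : V → List V) :
    ℕ → V → TarjanState V → Timed (TarjanState V × ℕ)
  | 0, _, s => pure (s, s.next)
  | depth + 1, v, s => do
    tick 1
    let n := s.next
    let r ← loop (fun (r : TarjanState V × ℕ) (w : V) =>
        match r.1.num w with
        | none => do
          let q ← visit adj depth w r.1
          pure (q.1, min r.2 q.2)
        | some m => if r.1.comp w = none then pure (r.1, min r.2 m) else pure r)
      ({ s with
          next := n + 1
          num := Function.update s.num v (some n)
          stack := v :: s.stack }, n)
      (adj v)
    if r.2 = n then do
      let p ← popUntil v r.1.stack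
      let c ← loop (fun (c : V → Option ℕ) w => pure (Function.update c w (some n))) r.1.comp p.1
      pure ({ r.1 with stack := p.2, comp := c, sccs := p.1 :: r.1.sccs }, n)
    else pure r

/-- Tarjan's algorithm. A chain of nested calls visits pairwise distinct nodes, so the recursion is never
deeper than the number of nodes. -/
noncomputable def tarjan {V : Type} [DecidableEq V] (nodes : Finset V) (adj : V → List V) :
    Timed (TarjanState V) :=
  loop (fun (s : TarjanState V) v =>
      match s.num v with
      | none => do
        let r ← visit adj nodes.card v s
        pure r.1
      | some _ => pure s)
    (TarjanState.empty V) nodes.toList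

/-! ## The state of an agent -/

/-- What Phase 1 tells an agent to do next: wait for the next round, run Phase 3, run Phases 2 and 4,
or exit. -/
inductive Role
  | idle
  | source
  | target
  | exited
  deriving DecidableEq

structure Agent (V : Type) where
  role : Role
  /-- the edges known to the agent -/
  known : Finset (V × V)
  /-- the edges that were new in the last pass of the edge propagation -/
  fresh : Finset (V × V)
  /-- whether the agent is still inside the loop of the edge propagation -/
  active : Bool
  /-- the SCCs of the known edges -/
  scc : TarjanState V
  /-- Phase 2: the representatives of the known s-SCCs, that is both the contents and the recipients of
  the message sent in Phase 2; empty if no such message was sent in this round -/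
  offer : Finset V
  /-- Phase 3: the targets that proposed to the agent -/
  proposers : Finset V
  /-- Phase 3: the target to which the agent proposes -/
  choice : Option V

def Agent.initial (V : Type) : Agent V :=
  ⟨.idle, ∅, ∅, false, TarjanState.empty V, ∅, ∅, none⟩

/-! ## The local programs

Each program is run by one agent `u`. It sees the state `a` of the agent, its neighbours in the current
network and the messages sent to it. It returns the new state of the agent and the edges which the agent
adds to the network. -/

/-- Phase 1, initialization: the agent knows the edges to its out-neighbours `out`. -/
noncomputable def beginRound {V : Type} [DecidableEq V] (u : V) (out : Finset V) : Timed (Agent V × Finset (V × V)) := do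
  tick 1
  let x ← loop (fun (x : Finset (V × V)) v => pure (insert (u, v) x)) ∅ out.toList
  pure ({ Agent.initial V with known := x, fresh := x, active := true }, ∅)

/-- Phase 1, one pass of the loop of the edge propagation: send the new edges to all out-neighbours,
receive from every in-neighbour `v` its new edges `msg v`, and stay in the loop if there was something
new among them. -/
noncomputable def propagate {V : Type} [DecidableEq V] (a : Agent V) (out inn : Finset V)
    (msg : V → Finset (V × V)) : Timed (Agent V × Finset (V × V)) := do
  tick 1
  if a.active then do
    tick (out.card * (a.fresh.card + 1))
    let r ← loop (fun (r : Finset (V × V) × Finset (V × V)) v =>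
        loop (fun (r : Finset (V × V) × Finset (V × V)) e =>
            if e ∈ r.1 then pure r else pure (insert e r.1, insert e r.2))
          r (msg v).toList)
      (a.known, ∅) inn.toList
    pure ({ a with known := r.1, fresh := r.2, active := !decide (r.2 = ∅) }, ∅)
  else pure (a, ∅)

/-- Phase 1, computation of the SCCs from the known edges, and classification of the SCC of `u`. -/
noncomputable def classify {V : Type} [LinearOrder V] (u : V) (a : Agent V) : Timed (Agent V × Finset (V × V)) := do
  tick 1
  let g ← loop (fun (g : Finset V × (V → List V)) (e : V × V) =>
      pure (insert e.1 (insert e.2 g.1), Function.update g.2 e.1 (e.2 :: g.2 e.1)))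
    ({u}, fun _ => []) a.known.toList
  let s ← tarjan g.1 g.2
  let hasIn ← loop (fun (b : Bool) (e : V × V) =>
      pure (b || (decide (s.comp e.1 ≠ s.comp u) && decide (s.comp e.2 = s.comp u))))
    false a.known.toList
  let hasOut ← loop (fun (b : Bool) (e : V × V) =>
      pure (b || (decide (s.comp e.1 = s.comp u) && decide (s.comp e.2 ≠ s.comp u))))
    false a.known.toList
  let rep ← loop (fun (m w : V) => pure (if s.comp w = s.comp u then min m w else m)) u g.1.toList
  let role : Role :=
    if hasIn = false ∧ hasOut = false then .exited
    else if hasIn = false ∧ u = rep then .source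
    else if hasOut = false ∧ u = rep then .target
    else .idle
  pure ({ a with role := role, scc := s }, ∅)

/-- The smallest element of a list. -/
def smallest {V : Type} [LinearOrder V] (l : List V) : Timed (Option V) :=
  loop (fun (m : Option V) w =>
      match m with
      | none => pure (some w)
      | some x => pure (some (min x w)))
    none l

/-- Phase 2: the representative of a t-SCC collects the representatives of the s-SCCs that it knows and
sends the set of these representatives to each of them. -/
noncomputable def phase2 {V : Type} [LinearOrder V] (a : Agent V) : Timed (Agent V × Finset (V × V)) := do
  tick 1
  if a.role = .target then do
    let entered ← loop (fun (h : Finset (Option ℕ)) (e : V × V) =>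
        if a.scc.comp e.1 ≠ a.scc.comp e.2 then pure (insert (a.scc.comp e.2) h) else pure h)
      ∅ a.known.toList
    let reps ← loop (fun (R : Finset V) (S : List V) => do
        let m ← smallest S
        match m with
        | none => pure R
        | some s => if a.scc.comp s ∈ entered then pure R else pure (insert s R))
      ∅ a.scc.sccs
    tick (reps.card * (reps.card + 1))
    pure ({ a with offer := reps }, ∅)
  else pure (a, ∅)

/-- Phase 3: the representative `u` of an s-SCC has received, in the order of the list `inbox`, the
proposals of the targets `t` in `inbox`, with the messages `msg t`. It proposes to the first target whose
message has more than one element, if there is one; otherwise it adds all edges from its proposers to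
itself. -/
def phase3 {V : Type} [DecidableEq V] (u : V) (a : Agent V) (inbox : List V)
    (msg : V → Finset V) : Timed (Agent V × Finset (V × V)) := do
  tick 1
  if a.role = .source then do
    let P ← loop (fun (P : Finset V) t => do
        tick (1 + (msg t).card)
        pure (insert t P))
      ∅ inbox
    let c ← search (fun t => decide (1 < (msg t).card)) inbox
    match c with
    | some t => do
      tick (1 + P.card)
      pure ({ a with proposers := P, choice := some t }, ∅)
    | none => do
      let F ← loop (fun (F : Finset (V × V)) t => pure (insert (t, u) F)) ∅ inbox
      pure ({ a with proposers := P }, F)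
  else pure (a, ∅)

/-- Phase 4: the representative `u` of a t-SCC has received, in the order of the list `inbox`, the
proposals of the sources `s` in `inbox`, with the messages `msg s`. It adds the edge to the first source
whose message has more than one element, if there is one; otherwise it adds the edges to all of them. -/
def phase4 {V : Type} [DecidableEq V] (u : V) (a : Agent V) (inbox : List V)
    (msg : V → Finset V) : Timed (Agent V × Finset (V × V)) := do
  tick 1
  if a.role = .target then do
    let _ ← loop (fun (_ : Unit) s => tick (1 + (msg s).card)) () inbox
    let c ← search (fun s => decide (1 < (msg s).card)) inbox
    match c with
    | some s => pure (a, {(u, s)})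
    | none => do
      let F ← loop (fun (F : Finset (V × V)) s => pure (insert (u, s) F)) ∅ inbox
      pure (a, F)
  else pure (a, ∅)

/-! ## The synchronous network -/

/-- The stages of a round. -/
inductive Stage
  | start
  | propagation
  | classification
  | second
  | third
  | fourth

structure Net (V : Type) where
  stage : Stage
  /-- the edges added so far -/
  added : Finset (V × V)
  agent : V → Agent V
  /-- the number of steps that each agent has spent so far -/
  time : V → ℕ

def Net.initial (V : Type) : Net V :=
  ⟨.start, ∅, fun _ => Agent.initial V, fun _ => 0⟩

/-- All agents that have not exited run their programs `prog`; afterwards the network is in the stage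
`next`. -/
def Net.exec {V : Type} [Fintype V] [DecidableEq V] (N : Net V) (next : Stage)
    (prog : V → Timed (Agent V × Finset (V × V))) : Net V :=
  let act : V → Timed (Agent V × Finset (V × V)) := fun u =>
    if (N.agent u).role = .exited then pure (N.agent u, ∅) else prog u
  { stage := next
    added := N.added ∪ Finset.univ.biUnion fun u => (act u).val.2
    agent := fun u => (act u).val.1
    time := fun u => N.time u + (act u).steps }

/-- The order in which the messages that an agent receives at some time arrive, as a function of the
time, the agent and the set of the senders. -/
structure DeliveryOrder (V : Type) where
  order : ℕ → V → Finset V → List V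
  isEnum : ∀ n u s, (order n u s : Multiset V) = s.val

/-- The out-neighbours of `u`. -/
def outNbrs {V : Type} [Fintype V] [DecidableEq V] (E : Finset (V × V)) (u : V) : Finset V :=
  Finset.univ.filter fun v => (u, v) ∈ E

/-- The in-neighbours of `u`. -/
def inNbrs {V : Type} [Fintype V] [DecidableEq V] (E : Finset (V × V)) (u : V) : Finset V :=
  Finset.univ.filter fun v => (v, u) ∈ E

/-- One synchronous step of the algorithm, at time `n`, on the digraph with edge set `E`. A round goes
once through all stages; it stays in the edge propagation until no agent is in its loop any more. -/
noncomputable def Net.step {V : Type} [Fintype V] [LinearOrder V] (E : Finset (V × V))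
    (ord : DeliveryOrder V) (n : ℕ) (N : Net V) : Net V :=
  let E' := E ∪ N.added
  match N.stage with
  | .start => N.exec .propagation fun u => beginRound u (outNbrs E' u)
  | .propagation =>
    if ∃ u, (N.agent u).active = true then
      N.exec .propagation fun u =>
        propagate (N.agent u) (outNbrs E' u) (inNbrs E' u) fun v =>
          if (N.agent v).active then (N.agent v).fresh else ∅
    else { N with stage := .classification }
  | .classification => N.exec .second fun u => classify u (N.agent u)
  | .second => N.exec .third fun u => phase2 (N.agent u)
  | .third => N.exec .fourth fun u =>
      phase3 u (N.agent u)
        (ord.order n u (Finset.univ.filter fun t => u ∈ (N.agent t).offer))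
        fun t => (N.agent t).offer
  | .fourth => N.exec .start fun u =>
      phase4 u (N.agent u)
        (ord.order n u (Finset.univ.filter fun s => (N.agent s).choice = some u))
        fun s => (N.agent s).proposers

/-- The state of the network after `n` synchronous steps. -/
noncomputable def run {V : Type} [Fintype V] [LinearOrder V] (E : Finset (V × V))
    (ord : DeliveryOrder V) : ℕ → Net V
  | 0 => Net.initial V
  | n + 1 => Net.step E ord n (run E ord n)

end DigraphAug

/-! The time of an agent is bounded by the number of rounds times the cost of one round.

Number of rounds. Let `F` be the digraph at the start of a round, weakly but not strongly connected.
`IsSrc` and `IsTgt` single out the representatives of components that no edge enters or leaves, and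
`Augmentation` records all that one round does to `F`. If some source `s` makes no proposal, then
every target reached from `s` is reached from no other source. The set of nodes reached from `s` is
then closed under edges in both directions, so it is everything, and the edges from all targets to
`s` make the digraph strongly connected. Otherwise every source proposes to exactly one target, and
every added edge goes from a chosen target to its proposer. If no added edge ends in a source that
reaches a second target, every source reaches only one target; weak connectivity then leaves a
single target, every source receives an edge from it, and again the result is strongly connected. If
there is an added edge from `t` to a source that reaches another target `t'`, then `t` and `t'` can
no longer account for two different targets, so the number of targets drops, and the number of
sources drops by a count in `Augmentation.card_add_le`. So each round either makes the digraph
strongly connected or lowers both numbers (`Augmentation.progress`). One further round lets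
everybody notice strong connectivity and exit, whence at most one round more than the smaller of the
two numbers (`exists_exited`).

Number of edges. The same count shows that the number of edges added in a round is at most twice the
drop in the number of sources. Hence at most `2|V|` edges are added before the round that makes the
digraph strongly connected, and at most `|V|` in that round. As `|V| ≤ 2|E|` by weak connectivity,
the digraph keeps `O(|E|)` edges.

Cost of a round. After `k` passes an agent knows the edges that start in a ball around it
(`ballEdges`). A ball that still grows has grown in every pass, so there are at most `|V|` passes.
Every edge is new to an agent at most once, so the sizes of the messages telescope to `O(|V||F|)`
(`traffic`). At the end `u` knows exactly the edges that start at nodes reaching `u`. These suffice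
to recover the components of `F` among the nodes that reach `u`. Tarjan's algorithm is linear
(`tarjan_spec`), and Phases 2 to 4 cost `O(|V|² + |F|)`. -/

namespace DigraphAug

/-! ### Values and costs of loops and linear search. -/

namespace Timed

variable {α β : Type}

@[simp] theorem val_pure (a : α) : (pure a : Timed α).val = a := rfl
@[simp] theorem steps_pure (a : α) : (pure a : Timed α).steps = 0 := rfl
@[simp] theorem val_bind (x : Timed α) (f : α → Timed β) : (x >>= f).val = (f x.val).val := rfl
@[simp] theorem steps_bind (x : Timed α) (f : α → Timed β) :
    (x >>= f).steps = x.steps + (f x.val).steps := rfl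
@[simp] theorem val_tick (n : ℕ) : (tick n).val = () := rfl
@[simp] theorem steps_tick (n : ℕ) : (tick n).steps = n := rfl

@[simp] theorem loop_nil_val (f : β → α → Timed β) (b : β) : (loop f b []).val = b := rfl
@[simp] theorem loop_nil_steps (f : β → α → Timed β) (b : β) : (loop f b []).steps = 1 := rfl
@[simp] theorem loop_cons_val (f : β → α → Timed β) (b : β) (a : α) (l : List α) :
    (loop f b (a :: l)).val = (loop f (f b a).val l).val := rfl
@[simp] theorem loop_cons_steps (f : β → α → Timed β) (b : β) (a : α) (l : List α) :
    (loop f b (a :: l)).steps = 1 + ((f b a).steps + (loop f (f b a).val l).steps) := rfl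

theorem loop_steps_le (f : β → α → Timed β) (c : α → ℕ) (l : List α)
    (h : ∀ b, ∀ a ∈ l, (f b a).steps ≤ c a) (b : β) :
    (loop f b l).steps ≤ (l.map c).sum + l.length + 1 := by
  induction l generalizing b with
  | nil => simp
  | cons a l ih =>
    have h1 := h b a (by simp)
    have h2 := ih (fun b x hx => h b x (by simp [hx])) (f b a).val
    simp only [loop_cons_steps, List.map_cons, List.sum_cons, List.length_cons]
    omega

theorem loop_steps_le_const (f : β → α → Timed β) (c : ℕ) (l : List α)
    (h : ∀ b, ∀ a ∈ l, (f b a).steps ≤ c) (b : β) :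
    (loop f b l).steps ≤ (c + 1) * l.length + 1 := by
  have := loop_steps_le f (fun _ => c) l h b
  simp only [List.map_const', List.sum_replicate, smul_eq_mul] at this
  linarith [this]

theorem search_steps_le (p : α → Bool) (l : List α) : (search p l).steps ≤ l.length + 1 := by
  induction l with
  | nil => simp [search]
  | cons a l ih =>
    by_cases h : p a <;> simp [search, h]
    omega

theorem search_eq_some {p : α → Bool} {l : List α} {a : α} (h : (search p l).val = some a) :
    a ∈ l ∧ p a = true := by
  induction l with
  | nil => simp [search] at h
  | cons b l ih =>
    by_cases hb : p b <;> simp [search, hb] at h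
    · subst h; simp [hb]
    · have := ih h
      simp [this]

theorem search_eq_none {p : α → Bool} {l : List α} (h : (search p l).val = none) :
    ∀ a ∈ l, p a = false := by
  induction l with
  | nil => simp
  | cons b l ih =>
    by_cases hb : p b <;> simp [search, hb] at h
    have := ih h
    simpa [hb] using this

/-- The result of inserting the elements of a list that satisfy `p`, one after another. -/
theorem mem_loop_insert [DecidableEq β] (p : α → Prop) [DecidablePred p] (g : α → β)
    (f : Finset β → α → Timed (Finset β))
    (hf : ∀ F a, (f F a).val = if p a then insert (g a) F else F) (F : Finset β) (l : List α)
    (x : β) : x ∈ (loop f F l).val ↔ x ∈ F ∨ ∃ a ∈ l, p a ∧ g a = x := by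
  induction l generalizing F with
  | nil => simp
  | cons a l ih =>
    rw [loop_cons_val, ih, hf]
    by_cases ha : p a <;> simp [ha]
    tauto

theorem loop_insert [DecidableEq β] (g : α → β) (f : Finset β → α → Timed (Finset β))
    (hf : ∀ F a, (f F a).val = insert (g a) F) (F : Finset β) (l : List α)
    (x : β) : x ∈ (loop f F l).val ↔ x ∈ F ∨ ∃ a ∈ l, g a = x := by
  have := mem_loop_insert (fun _ : α => True) g f (by simpa using hf) F l x
  simpa using this

theorem loop_or (p : α → Bool) (f : Bool → α → Timed Bool)
    (hf : ∀ b a, (f b a).val = (b || p a)) (b : Bool) (l : List α) :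
    (loop f b l).val = true ↔ b = true ∨ ∃ a ∈ l, p a = true := by
  induction l generalizing b with
  | nil => simp
  | cons a l ih =>
    rw [loop_cons_val, ih, hf]
    simp [or_assoc]

end Timed

open Timed

/-! ### Correctness and cost of Tarjan's algorithm -/

section Tarjan

set_option linter.unusedSectionVars false

variable {V : Type} [DecidableEq V]

theorem popUntil_spec (v : V) (l : List V) (h : v ∈ l) :
    ∃ l' rest, v ∉ l' ∧ l = l' ++ v :: rest ∧ (popUntil v l).val = (l' ++ [v], rest) ∧
      (popUntil v l).steps = l'.length + 1 := by
  induction l with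
  | nil => simp at h
  | cons w l ih =>
    by_cases hw : w = v
    · subst hw
      exact ⟨[], l, by simp, by simp, by simp [popUntil], by simp [popUntil]⟩
    · have hv : v ∈ l := by
        rcases List.mem_cons.1 h with h | h
        · exact absurd h.symm hw
        · exact h
      obtain ⟨l', rest, h1, h2, h3, h4⟩ := ih hv
      refine ⟨w :: l', rest, ?_, by simp [h2], ?_, ?_⟩
      · simp [h1, Ne.symm hw]
      · simp [popUntil, hw, h3]
      · simp [popUntil, hw, h4]; omega

theorem loop_update_apply (n : ℕ) (c : V → Option ℕ) (l : List V) (w : V) :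
    (loop (fun (c : V → Option ℕ) w => pure (Function.update c w (some n))) c l).val w =
      if w ∈ l then some n else c w := by
  induction l generalizing c with
  | nil => simp
  | cons a l ih =>
    rw [loop_cons_val, ih]
    by_cases hl : w ∈ l
    · simp [hl]
    · by_cases ha : w = a
      · subst ha; simp [hl]
      · simp [hl, ha]

theorem loop_update_steps (n : ℕ) (c : V → Option ℕ) (l : List V) :
    (loop (fun (c : V → Option ℕ) w => pure (Function.update c w (some n))) c l).steps =
      l.length + 1 := by
  induction l generalizing c with
  | nil => simp
  | cons a l ih => rw [loop_cons_steps, ih]; simp; omega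

/-- The body of the loop of `visit`. -/
def visitEdge (adj : V → List V) (depth : ℕ) (r : TarjanState V × ℕ) (w : V) :
    Timed (TarjanState V × ℕ) :=
  match r.1.num w with
  | none => do
    let q ← visit adj depth w r.1
    pure (q.1, min r.2 q.2)
  | some m => if r.1.comp w = none then pure (r.1, min r.2 m) else pure r

/-- The state in which the loop of `visit` starts. -/
def TarjanState.push (s : TarjanState V) (v : V) : TarjanState V :=
  { s with
    next := s.next + 1
    num := Function.update s.num v (some s.next)
    stack := v :: s.stack }

/-- Completion of the component of `v`. -/
def finish (v : V) (n : ℕ) (r : TarjanState V × ℕ) : Timed (TarjanState V × ℕ) :=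
  if r.2 = n then do
    let p ← popUntil v r.1.stack
    let c ← loop (fun (c : V → Option ℕ) w => pure (Function.update c w (some n))) r.1.comp p.1
    pure ({ r.1 with stack := p.2, comp := c, sccs := p.1 :: r.1.sccs }, n)
  else pure r

theorem visit_succ (adj : V → List V) (depth : ℕ) (v : V) (s : TarjanState V) :
    visit adj (depth + 1) v s = (do
      tick 1
      let r ← loop (visitEdge adj depth) (s.push v, s.next) (adj v)
      finish v s.next r) := rfl

def Path (adj : V → List V) : V → V → Prop := Relation.ReflTransGen fun a b => b ∈ adj a

/-- The state of Tarjan's algorithm between two calls, when the calls at the nodes of `g` are running. -/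
structure TarjanInv (nodes : Finset V) (adj : V → List V) (g : Set V) (s : TarjanState V) :
    Prop where
  num_lt : ∀ v m, s.num v = some m → m < s.next
  num_inj : ∀ v w m, s.num v = some m → s.num w = some m → v = w
  mem_nodes : ∀ v, s.num v ≠ none → v ∈ nodes
  mem_stack : ∀ v, v ∈ s.stack ↔ s.num v ≠ none ∧ s.comp v = none
  sorted : s.stack.Pairwise fun a b => ∀ m k, s.num a = some m → s.num b = some k → k < m
  visited_of_comp : ∀ v, s.comp v ≠ none → s.num v ≠ none
  gray : ∀ v ∈ g, s.num v ≠ none ∧ s.comp v = none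
  closed_num : ∀ v, s.num v ≠ none → v ∉ g → ∀ w ∈ adj v, s.num w ≠ none
  closed_comp : ∀ v, s.comp v ≠ none → ∀ w ∈ adj v, s.comp w ≠ none
  -- Open nodes discovered after a running call are reached from it. With the next field this makes
  -- the block popped at a root mutually reachable.
  reach_of_gray : ∀ x ∈ g, ∀ m y k, s.num x = some m → s.num y = some k → s.comp y = none →
    m ≤ k → Path adj x y
  reach_gray : ∀ y k, s.num y = some k → s.comp y = none →
    ∃ x ∈ g, ∃ m ≤ k, s.num x = some m ∧ Path adj y x
  root : ∀ v k, s.comp v = some k → ∃ x, s.num x = some k ∧ s.comp x = some k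
  comp_iff : ∀ v w, s.comp v ≠ none → s.comp w ≠ none →
    (s.comp v = s.comp w ↔ Path adj v w ∧ Path adj w v)
  sccs : ∀ S ∈ s.sccs, ∃ v, s.comp v ≠ none ∧ ∀ w, w ∈ S ↔ s.comp w = s.comp v
  cover : ∀ v, s.comp v ≠ none → ∃ S ∈ s.sccs, v ∈ S
  nodup : s.sccs.flatten.Nodup

/-- `s'` is a later state than `s`. -/
structure TarjanExt (s s' : TarjanState V) : Prop where
  next_le : s.next ≤ s'.next
  num : ∀ w m, s.num w = some m → s'.num w = some m
  comp : ∀ w, s.num w ≠ none → s'.comp w = s.comp w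
  new : ∀ w m, s.num w = none → s'.num w = some m → s.next ≤ m

theorem TarjanExt.refl (s : TarjanState V) : TarjanExt s s :=
  ⟨le_rfl, fun _ _ h => h, fun _ _ => rfl, fun w m h h' => by simp [h] at h'⟩

theorem TarjanExt.visited {s s' : TarjanState V} (h : TarjanExt s s') {w : V}
    (hw : s.num w ≠ none) : s'.num w = s.num w := by
  obtain ⟨m, hm⟩ := Option.ne_none_iff_exists'.1 hw
  rw [hm, h.num w m hm]

theorem TarjanExt.trans {s s' s'' : TarjanState V} (h : TarjanExt s s') (h' : TarjanExt s' s'') :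
    TarjanExt s s'' := by
  refine ⟨h.next_le.trans h'.next_le, fun w m hw => h'.num w m (h.num w m hw), fun w hw => ?_,
    fun w m hw hm => ?_⟩
  · rw [h'.comp w (by rwa [h.visited hw]), h.comp w hw]
  · by_cases h1 : s'.num w = none
    · exact h.next_le.trans (h'.new w m h1 hm)
    · rw [h'.visited h1] at hm
      exact h.new w m hw hm

/-- What Tarjan's algorithm may have spent until the state `s`. -/
def weight (nodes : Finset V) (adj : V → List V) (s : TarjanState V) : ℕ :=
  -- The 3 pays for entering `visit`, for leaving its loop and for leaving the loop that labels a
  -- popped block; the degree pays for the passes over the edges. The factor 2 below pays for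
  -- popping and labelling a node.
  (∑ a ∈ nodes, if s.num a = none then 0 else 3 + (adj a).length) +
    2 * ∑ a ∈ nodes, if s.comp a = none then 0 else 1

/-- The state of the loop of `visit` at `v`, called in the state `s`. -/
structure VisitInv (nodes : Finset V) (adj : V → List V) (g : Set V) (v : V) (s : TarjanState V)
    (r : TarjanState V × ℕ) : Prop where
  inv : TarjanInv nodes adj (insert v g) r.1
  ext : TarjanExt s r.1
  num : r.1.num v = some s.next
  low_le : r.2 ≤ s.next
  low : ∃ z, r.1.num z = some r.2 ∧ r.1.comp z = none ∧ Path adj v z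
  cross : ∀ a, a ≠ v → s.num a = none → r.1.num a ≠ none → r.1.comp a = none →
    ∀ b ∈ adj a, ∀ m, r.1.num b = some m → r.1.comp b = none → r.2 ≤ m

/-- The edge to `b` has been taken care of. -/
def Scanned (r : TarjanState V × ℕ) (b : V) : Prop :=
  r.1.num b ≠ none ∧ ∀ m, r.1.num b = some m → r.1.comp b = none → r.2 ≤ m

/-- The outcome of `visit` at `v`, called in the state `s`. -/
structure Visited (nodes : Finset V) (adj : V → List V) (g : Set V) (v : V) (s : TarjanState V)
    (r : TarjanState V × ℕ) : Prop where
  inv : TarjanInv nodes adj g r.1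
  ext : TarjanExt s r.1
  num : r.1.num v = some s.next
  low_le : r.2 ≤ s.next
  -- If the call has completed the component of `v`, the lowlink is `s.next` and `z = v` is no
  -- longer open; hence the proviso.
  low : ∃ z, r.1.num z = some r.2 ∧ Path adj v z ∧ (r.2 < s.next → r.1.comp z = none)
  cross : ∀ a, s.num a = none → r.1.num a ≠ none → r.1.comp a = none →
    ∀ b ∈ adj a, ∀ m, r.1.num b = some m → r.1.comp b = none → r.2 ≤ m

theorem weight_push {nodes : Finset V} {adj : V → List V} {s : TarjanState V} {v : V}
    (hv : v ∈ nodes) (hs : s.num v = none) :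
    weight nodes adj (s.push v) = weight nodes adj s + 3 + (adj v).length := by
  unfold weight TarjanState.push
  simp only
  rw [← Finset.add_sum_erase _ _ hv,
    ← Finset.add_sum_erase nodes (fun a => if s.num a = none then 0 else 3 + (adj a).length) hv,
    Finset.sum_congr rfl (g := fun a => if s.num a = none then 0 else 3 + (adj a).length)]
  · simp [hs]; omega
  · intro x hx
    simp [Finset.ne_of_mem_erase hx]

/-- The invariant holds at the start of the loop of `visit`. -/
theorem VisitInv.push {nodes : Finset V} {adj : V → List V} {g : Set V} {v : V}
    {s : TarjanState V} (h : TarjanInv nodes adj g s) (hv : v ∈ nodes) (hs : s.num v = none)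
    (hg : ∀ x ∈ g, Path adj x v) : VisitInv nodes adj g v s (s.push v, s.next) := by
  have hcv : s.comp v = none := by
    by_contra hc
    exact h.visited_of_comp v hc hs
  have num_self : (s.push v).num v = some s.next := by simp [TarjanState.push]
  have num_ne : ∀ w, w ≠ v → (s.push v).num w = s.num w := fun w hw => by
    simp [TarjanState.push, hw]
  have old : ∀ w m, s.num w = some m → (s.push v).num w = some m := fun w m hw => by
    rw [num_ne w (by rintro rfl; simp [hs] at hw), hw]
  have cases_num : ∀ w m, (s.push v).num w = some m → (w = v ∧ m = s.next) ∨ s.num w = some m := by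
    intro w m hw
    by_cases hwv : w = v
    · subst hwv; left; rw [num_self] at hw; exact ⟨rfl, by simpa using hw.symm⟩
    · right; rwa [num_ne w hwv] at hw
  have ne_none : ∀ w, (s.push v).num w ≠ none ↔ w = v ∨ s.num w ≠ none := by
    intro w
    by_cases hwv : w = v
    · subst hwv; simp [num_self]
    · simp [hwv, num_ne]
  have comp_eq : (s.push v).comp = s.comp := rfl
  refine ⟨?_, ?_, num_self, le_rfl, ⟨v, num_self, hcv, .refl⟩, ?_⟩
  · constructor
    · intro w m hw
      show m < s.next + 1
      rcases cases_num w m hw with ⟨_, rfl⟩ | hw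
      · omega
      · have := h.num_lt w m hw; omega
    · intro w x m hw hx
      rcases cases_num w m hw with ⟨h1, h2⟩ | hw' <;> rcases cases_num x _ hx with ⟨h3, h4⟩ | hx'
      · rw [h1, h3]
      · exact absurd (h.num_lt _ _ hx') (by omega)
      · exact absurd (h.num_lt _ _ hw') (by omega)
      · exact h.num_inj _ _ _ hw' hx'
    · intro w hw
      rcases (ne_none w).1 hw with rfl | hw
      · exact hv
      · exact h.mem_nodes w hw
    · intro w
      rw [ne_none, comp_eq]
      show w ∈ v :: s.stack ↔ _
      rw [List.mem_cons, h.mem_stack]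
      constructor
      · rintro (rfl | hw)
        · exact ⟨.inl rfl, hcv⟩
        · exact ⟨.inr hw.1, hw.2⟩
      · rintro ⟨rfl | hw, hc⟩
        · exact .inl rfl
        · exact .inr ⟨hw, hc⟩
    · show (v :: s.stack).Pairwise _
      rw [List.pairwise_cons]
      have hne : ∀ a ∈ s.stack, a ≠ v := by
        rintro a ha rfl
        exact ((h.mem_stack a).1 ha).1 hs
      constructor
      · intro a ha m k hm hk
        rw [num_self] at hm
        rw [num_ne a (hne a ha)] at hk
        have := h.num_lt a k hk
        simp at hm; omega
      · refine h.sorted.imp_of_mem ?_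
        intro a b ha hb hab m k hm hk
        rw [num_ne a (hne a ha)] at hm
        rw [num_ne b (hne b hb)] at hk
        exact hab m k hm hk
    · intro w hw
      exact (ne_none w).2 (.inr (h.visited_of_comp w hw))
    · rintro w (rfl | hw)
      · exact ⟨(ne_none w).2 (.inl rfl), hcv⟩
      · exact ⟨(ne_none w).2 (.inr (h.gray w hw).1), (h.gray w hw).2⟩
    · intro w hw hwg x hx
      rw [Set.mem_insert_iff, not_or] at hwg
      refine (ne_none x).2 (.inr (h.closed_num w ?_ hwg.2 x hx))
      exact ((ne_none w).1 hw).resolve_left hwg.1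
    · exact h.closed_comp
    · rintro x (rfl | hx) m y k hm hk hc hmk
      · rw [num_self] at hm
        rcases cases_num y k hk with ⟨rfl, _⟩ | hk
        · exact .refl
        · have := h.num_lt y k hk
          simp at hm; omega
      · rcases cases_num y k hk with ⟨rfl, _⟩ | hk
        · exact hg x hx
        · rcases cases_num x m hm with ⟨rfl, _⟩ | hm
          · exact absurd hs (h.gray x hx).1
          · exact h.reach_of_gray x hx m y k hm hk hc hmk
    · intro y k hk hc
      rcases cases_num y k hk with ⟨rfl, rfl⟩ | hk
      · exact ⟨y, .inl rfl, _, le_rfl, num_self, .refl⟩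
      · obtain ⟨x, hx, m, hmk, hm, hp⟩ := h.reach_gray y k hk hc
        exact ⟨x, .inr hx, m, hmk, old x m hm, hp⟩
    · intro w k hk
      obtain ⟨x, hx, hx'⟩ := h.root w k hk
      exact ⟨x, old x k hx, hx'⟩
    · exact h.comp_iff
    · exact h.sccs
    · exact h.cover
    · exact h.nodup
  · refine ⟨by simp [TarjanState.push], old, fun _ _ => rfl, fun w m hw hm => ?_⟩
    rcases cases_num w m hm with ⟨_, rfl⟩ | hm
    · exact le_rfl
    · simp [hw] at hm
  · intro a hav ha ha'
    exact absurd ((ne_none a).1 ha') (by simp [hav, ha])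

/-- One pass of the loop of `visit`, given the correctness of the recursive call. -/
theorem VisitInv.visitEdge {nodes : Finset V} {adj : V → List V} {g : Set V} {v : V}
    {s : TarjanState V} {depth : ℕ}
    (hrec : ∀ (g : Set V) (w : V) (s : TarjanState V), TarjanInv nodes adj g s → w ∈ nodes →
      s.num w = none → (∀ x ∈ g, Path adj x w) → (nodes.filter fun a => s.num a = none).card ≤ depth →
      Visited nodes adj g w s (visit adj depth w s).val ∧
      weight nodes adj s + (visit adj depth w s).steps ≤ weight nodes adj (visit adj depth w s).val.1)
    {r : TarjanState V × ℕ} (h : VisitInv nodes adj g v s r) (hg : ∀ x ∈ g, Path adj x v)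
    (hgs : ∀ x ∈ g, s.num x ≠ none)
    (hd : (nodes.filter fun a => s.num a = none).card ≤ depth + 1) (hvn : s.num v = none)
    {w : V} (hw : w ∈ adj v) (hwn : w ∈ nodes) :
    VisitInv nodes adj g v s (DigraphAug.visitEdge adj depth r w).val ∧
    Scanned (DigraphAug.visitEdge adj depth r w).val w ∧
    (∀ b, Scanned r b → Scanned (DigraphAug.visitEdge adj depth r w).val b) ∧
    weight nodes adj r.1 + (DigraphAug.visitEdge adj depth r w).steps ≤
      weight nodes adj (DigraphAug.visitEdge adj depth r w).val.1 := by
  obtain ⟨s1, low⟩ := r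
  have hvnodes : v ∈ nodes := h.inv.mem_nodes v (by rw [h.num]; simp)
  unfold DigraphAug.visitEdge
  cases hnum : s1.num w with
  | some m =>
    by_cases hc : s1.comp w = none
    · simp only [hc, if_true, val_pure, steps_pure, add_zero, le_refl, and_true]
      refine ⟨⟨h.inv, h.ext, h.num, (min_le_left _ _).trans h.low_le, ?_, ?_⟩, ?_, ?_⟩
      · rcases min_choice low m with hm | hm <;> simp only [hm]
        · exact h.low
        · exact ⟨w, hnum, hc, .single hw⟩
      · intro a ha1 ha2 ha3 ha4 b hb k hk hkc
        exact (min_le_left _ _).trans (h.cross a ha1 ha2 ha3 ha4 b hb k hk hkc)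
      · refine ⟨by simp [hnum], fun k hk _ => ?_⟩
        simp only [hnum, Option.some.injEq] at hk
        subst hk
        exact min_le_right _ _
      · intro b hb
        exact ⟨hb.1, fun k hk hkc => (min_le_left _ _).trans (hb.2 k hk hkc)⟩
    · simp only [hc, if_false, val_pure, steps_pure, add_zero, le_refl, and_true]
      refine ⟨h, ⟨by simp [hnum], fun k _ hk => absurd hk hc⟩, fun b hb => hb⟩
  | none =>
    simp only [val_bind, steps_bind, val_pure, steps_pure, add_zero]
    -- The node `v` was unvisited in `s` and is visited in `s1`, so a nested call gets by with one
    -- level less.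
    have hcard : (nodes.filter fun a => s1.num a = none).card ≤ depth := by
      have hlt : (nodes.filter fun a => s1.num a = none).card <
          (nodes.filter fun a => s.num a = none).card := by
        apply Finset.card_lt_card
        refine ⟨fun a ha => ?_, fun hsub => ?_⟩
        · simp only [Finset.mem_filter] at ha ⊢
          refine ⟨ha.1, ?_⟩
          by_contra hc
          exact hc (by rw [← h.ext.visited hc]; exact ha.2)
        · have := hsub (Finset.mem_filter.2 ⟨hvnodes, hvn⟩)
          rw [Finset.mem_filter, h.num] at this
          simp at this
      omega
    have hg' : ∀ x ∈ insert v g, Path adj x w := by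
      rintro x (rfl | hx)
      · exact .single hw
      · exact (hg x hx).tail hw
    obtain ⟨hq, hcost⟩ := hrec (insert v g) w s1 h.inv hwn hnum hg' hcard
    set q := (visit adj depth w s1).val with hqdef
    have hle : s.next ≤ s1.next := h.ext.next_le
    have hnv : s1.num v ≠ none := by rw [h.num]; simp
    have hcv : s1.comp v = none := (h.inv.gray v (.inl rfl)).2
    refine ⟨⟨hq.inv, h.ext.trans hq.ext, hq.ext.num _ _ h.num, (min_le_left _ _).trans h.low_le,
      ?_, ?_⟩, ?_, ?_, hcost⟩
    · by_cases hlt : q.2 < low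
      · obtain ⟨z, hz, hp, hc⟩ := hq.low
        refine ⟨z, ?_, ?_, hp.head hw⟩
        · simp only [hz, Option.some.injEq]; omega
        · exact hc (lt_of_lt_of_le hlt (h.low_le.trans hle))
      · obtain ⟨z, hz, hc, hp⟩ := h.low
        refine ⟨z, ?_, ?_, hp⟩
        · simp only at hz
          rw [hq.ext.num _ _ hz]; simp; omega
        · rw [hq.ext.comp z (by simp only at hz; simp [hz])]; exact hc
    · intro a ha1 ha2 ha3 ha4 b hb k hk hkc
      by_cases ha : s1.num a = none
      · exact (min_le_right _ _).trans (hq.cross a ha ha3 ha4 b hb k hk hkc)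
      · refine (min_le_left _ _).trans ?_
        -- A visited node whose call is over has only visited out-neighbours, and the call at `w`
        -- changes neither their numbers nor their labels.
        have hag : a ∉ insert v g := by
          rintro (rfl | hag)
          · exact ha1 rfl
          · exact hgs a hag ha2
        have hb' := h.inv.closed_num a ha hag b hb
        rw [hq.ext.comp a ha] at ha4
        rw [hq.ext.comp b hb'] at hkc
        rw [hq.ext.visited hb'] at hk
        exact h.cross a ha1 ha2 ha ha4 b hb k hk hkc
    · refine ⟨by simp [hq.num], fun k hk _ => ?_⟩
      simp only [hq.num, Option.some.injEq] at hk
      rw [← hk]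
      exact (min_le_right _ _).trans hq.low_le
    · intro b hb
      have hb1 : s1.num b ≠ none := hb.1
      refine ⟨?_, fun k hk hkc => ?_⟩
      · rwa [hq.ext.visited hb1]
      · simp only at hk hkc
        rw [hq.ext.comp b hb1] at hkc
        rw [hq.ext.visited hb1] at hk
        exact (min_le_left _ _).trans (hb.2 k hk hkc)

end Tarjan

/-! ### Completion of a component: the two ways in which a call ends. -/

section Tarjan

set_option linter.unusedSectionVars false

variable {V : Type} [DecidableEq V]

theorem TarjanInv.comp_of_path {nodes : Finset V} {adj : V → List V} {g : Set V}
    {s : TarjanState V} (h : TarjanInv nodes adj g s) {x y : V} (hp : Path adj x y)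
    (hx : s.comp x ≠ none) : s.comp y ≠ none := by
  induction hp with
  | refl => exact hx
  | tail _ hbc ih => exact h.closed_comp _ ih _ hbc

/-- Here `v` is not the root of its component, which stays open. The point is that `reach_gray`
survives the end of the call at `v`: the node `v` reaches an open node numbered `r.2`, which reaches
a running call numbered at most `r.2`, and that call is not `v` because `r.2` is below the number of
`v`. -/
theorem VisitInv.visited_of_lt {nodes : Finset V} {adj : V → List V} {g : Set V} {v : V}
    {s : TarjanState V} {r : TarjanState V × ℕ} (h : VisitInv nodes adj g v s r)
    (hscan : ∀ w ∈ adj v, Scanned r w) (hlt : r.2 < s.next) (hvg : v ∉ g) :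
    Visited nodes adj g v s r := by
  have hi := h.inv
  refine ⟨⟨hi.num_lt, hi.num_inj, hi.mem_nodes, hi.mem_stack, hi.sorted, hi.visited_of_comp,
    fun w hw => hi.gray w (.inr hw), ?_, hi.closed_comp,
    fun x hx => hi.reach_of_gray x (.inr hx), ?_, hi.root, hi.comp_iff, hi.sccs, hi.cover,
    hi.nodup⟩, h.ext, h.num, h.low_le, ?_, ?_⟩
  · intro w hw hwg x hx
    by_cases hwv : w = v
    · subst hwv; exact (hscan x hx).1
    · exact hi.closed_num w hw (by simp [hwv, hwg]) x hx
  · intro y k hk hc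
    obtain ⟨x, hx, m, hmk, hm, hp⟩ := hi.reach_gray y k hk hc
    rcases hx with rfl | hx
    · obtain ⟨z, hz, hzc, hzp⟩ := h.low
      obtain ⟨x', hx', m', hm', hm'', hp'⟩ := hi.reach_gray z r.2 hz hzc
      rcases hx' with rfl | hx'
      · rw [h.num] at hm''
        simp at hm''; omega
      · rw [h.num] at hm
        simp only [Option.some.injEq] at hm
        exact ⟨x', hx', m', by omega, hm'', (hp.trans hzp).trans hp'⟩
    · exact ⟨x, hx, m, hmk, hm, hp⟩
  · obtain ⟨z, hz, hzc, hzp⟩ := h.low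
    exact ⟨z, hz, hzp, fun _ => hzc⟩
  · intro a ha1 ha2 ha3 b hb m hm hmc
    by_cases hav : a = v
    · subst hav; exact (hscan b hb).2 m hm hmc
    · exact h.cross a hav ha1 ha2 ha3 b hb m hm hmc

theorem weight_complete {nodes : Finset V} {adj : V → List V} {s s' : TarjanState V} {p : List V}
    (hp : p.Nodup) (hn : ∀ w ∈ p, w ∈ nodes) (hc : ∀ w ∈ p, s.comp w = none)
    (hnum : s'.num = s.num) {n : ℕ} (hcomp : ∀ w, s'.comp w = if w ∈ p then some n else s.comp w) :
    weight nodes adj s' = weight nodes adj s + 2 * p.length := by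
  have key : (∑ a ∈ nodes, if s'.comp a = none then 0 else 1) =
      (∑ a ∈ nodes, if s.comp a = none then 0 else 1) + p.length := by
    have h1 : p.length = ∑ a ∈ nodes, if a ∈ p then 1 else 0 := by
      rw [← Finset.card_filter, ← List.toFinset_card_of_nodup hp]
      congr 1
      ext a
      simp only [List.mem_toFinset, Finset.mem_filter]
      exact ⟨fun h => ⟨hn a h, h⟩, fun h => h.2⟩
    rw [h1, ← Finset.sum_add_distrib]
    refine Finset.sum_congr rfl fun a _ => ?_
    rw [hcomp]
    by_cases ha : a ∈ p
    · simp [ha, hc a ha]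
    · simp [ha]
  unfold weight
  rw [key, hnum]
  ring

/-- No edge leads from the open nodes numbered from `v` on to an earlier open node, so the popped
block is closed under edges up to completed nodes. The node `v` reaches the whole block by
`reach_of_gray`; conversely every node of the block reaches a running call, and by closedness this
can only be `v`. So the block is a component. The extra step in the cost is the exit from the
labelling loop, paid for when `v` was pushed. -/
theorem VisitInv.finish_of_eq {nodes : Finset V} {adj : V → List V} {g : Set V} {v : V}
    {s : TarjanState V} {r : TarjanState V × ℕ} (h : VisitInv nodes adj g v s r)
    (h0 : TarjanInv nodes adj g s) (hvn : s.num v = none)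
    (hscan : ∀ w ∈ adj v, Scanned r w) (heq : r.2 = s.next) :
    Visited nodes adj g v s (finish v s.next r).val ∧
    weight nodes adj r.1 + (finish v s.next r).steps ≤
      weight nodes adj (finish v s.next r).val.1 + 1 := by
  obtain ⟨s1, low⟩ := r
  simp only at heq
  subst heq
  have hi : TarjanInv nodes adj (insert v g) s1 := h.inv
  have hvnum : s1.num v = some s.next := h.num
  have hvc : s1.comp v = none := (hi.gray v (.inl rfl)).2
  have hvs : v ∈ s1.stack := (hi.mem_stack v).2 (hi.gray v (.inl rfl))
  obtain ⟨l', rest, hvl, hst, hpop, hsteps⟩ := popUntil_spec v s1.stack hvs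
  set p := l' ++ [v] with hp
  set c' : V → Option ℕ := fun w => if w ∈ p then some s.next else s1.comp w with hc'
  have hval : finish v s.next (s1, s.next) =
      ⟨({ s1 with stack := rest, comp := c', sccs := p :: s1.sccs }, s.next),
        2 * p.length + 1⟩ := by
    have e1 : (finish v s.next (s1, s.next)).val =
        ({ s1 with stack := rest, comp := c', sccs := p :: s1.sccs }, s.next) := by
      simp only [finish, if_true, val_bind, val_pure, hpop]
      congr 2
      funext w
      rw [loop_update_apply]
    have e2 : (finish v s.next (s1, s.next)).steps = 2 * p.length + 1 := by
      simp only [finish, if_true, steps_bind, steps_pure, hpop, hsteps, loop_update_steps]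
      simp [hp]; ring
    rw [← e1, ← e2]
  have hst' : s1.stack = p ++ rest := by rw [hst, hp]; simp
  have hsort := hi.sorted
  have hmemst : ∀ w, w ∈ s1.stack ↔ w ∈ p ∨ w ∈ rest := fun w => by rw [hst', List.mem_append]
  have hnd : s1.stack.Nodup := by
    refine hsort.imp_of_mem ?_
    rintro a b ha _ hab rfl
    obtain ⟨m, hm⟩ := Option.ne_none_iff_exists'.1 ((hi.mem_stack a).1 ha).1
    exact lt_irrefl _ (hab m m hm hm)
  have hpst : ∀ w ∈ p, s1.num w ≠ none ∧ s1.comp w = none := fun w hw =>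
    (hi.mem_stack w).1 ((hmemst w).2 (.inl hw))
  have hpge : ∀ w ∈ p, ∀ k, s1.num w = some k → s.next ≤ k := by
    intro w hw k hk
    rw [hp, List.mem_append] at hw
    rcases hw with hw | hw
    · rw [hst, List.pairwise_append] at hsort
      exact (hsort.2.2 w hw v (by simp) k s.next hk hvnum).le
    · simp only [List.mem_singleton] at hw
      subst hw
      rw [hvnum] at hk
      simp at hk; omega
  have hrest : ∀ w ∈ rest, ∀ k, s1.num w = some k → k < s.next := by
    intro w hw k hk
    rw [hst, List.pairwise_append, List.pairwise_cons] at hsort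
    exact hsort.2.1.1 w hw s.next k hvnum hk
  have hmemp : ∀ w k, s1.num w = some k → s1.comp w = none → s.next ≤ k → w ∈ p := by
    intro w k hk hc hle
    have hw : w ∈ s1.stack := (hi.mem_stack w).2 ⟨by simp [hk], hc⟩
    rcases (hmemst w).1 hw with hw | hw
    · exact hw
    · exact absurd (hrest w hw k hk) (by omega)
  have hold : ∀ w, s.num w ≠ none → w ∉ p := by
    intro w hw hwp
    obtain ⟨k, hk⟩ := Option.ne_none_iff_exists'.1 hw
    have h1 := hpge w hwp k (h.ext.num w k hk)
    have h2 := h0.num_lt w k hk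
    omega
  have hgp : ∀ w ∈ g, w ∉ p := fun w hw => hold w (h0.gray w hw).1
  have hvp : v ∈ p := by simp [hp]
  have hclosed : ∀ w ∈ p, ∀ x ∈ adj w, x ∈ p ∨ s1.comp x ≠ none := by
    intro w hw x hx
    by_cases hc : s1.comp x = none
    · left
      by_cases hwv : w = v
      · subst hwv
        obtain ⟨hx1, hx2⟩ := hscan x hx
        obtain ⟨k, hk⟩ := Option.ne_none_iff_exists'.1 hx1
        exact hmemp x k hk hc (hx2 k hk hc)
      · have hwg : w ∉ insert v g := by
          rintro (hwg | hwg)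
          · exact hwv hwg
          · exact hgp w hwg hw
        obtain ⟨k, hk⟩ :=
          Option.ne_none_iff_exists'.1 (hi.closed_num w (hpst w hw).1 hwg x hx)
        have hwn : s.num w = none := by
          by_contra hwn
          exact hold w hwn hw
        exact hmemp x k hk hc (h.cross w hwv hwn (hpst w hw).1 (hpst w hw).2 x hx k hk hc)
    · exact .inr hc
  have hclosed' : ∀ w x, Path adj w x → (w ∈ p ∨ s1.comp w ≠ none) →
      x ∈ p ∨ s1.comp x ≠ none := by
    intro w x hwx hw
    induction hwx with
    | refl => exact hw
    | tail _ hbc ih =>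
      rcases ih with ih | ih
      · exact hclosed _ ih _ hbc
      · exact .inr (hi.closed_comp _ ih _ hbc)
  have hmut : ∀ w ∈ p, Path adj v w ∧ Path adj w v := by
    intro w hw
    obtain ⟨k, hk⟩ := Option.ne_none_iff_exists'.1 (hpst w hw).1
    refine ⟨hi.reach_of_gray v (.inl rfl) _ w k hvnum hk (hpst w hw).2 (hpge w hw k hk), ?_⟩
    obtain ⟨x, hx, m, hmk, hm, hpath⟩ := hi.reach_gray w k hk (hpst w hw).2
    rcases hx with rfl | hx
    · exact hpath
    · exfalso
      rcases hclosed' w x hpath (.inl hw) with hxp | hxc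
      · exact hgp x hx hxp
      · exact hxc (hi.gray x (.inr hx)).2
  -- A label in use is the number of a completed root, but the node numbered `s.next` is `v`, which
  -- is still open.
  have hfresh : ∀ x, s1.comp x ≠ some s.next := by
    intro x hx
    obtain ⟨y, hy1, hy2⟩ := hi.root x _ hx
    rw [hi.num_inj y v _ hy1 hvnum, hvc] at hy2
    simp at hy2
  have hc'p : ∀ w ∈ p, c' w = some s.next := fun w hw => by simp [hc', hw]
  have hc'n : ∀ w, w ∉ p → c' w = s1.comp w := fun w hw => by simp [hc', hw]
  have hc'old : ∀ w, s1.comp w ≠ none → c' w = s1.comp w := fun w hw =>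
    hc'n w fun hwp => hw (hpst w hwp).2
  have hc'none : ∀ w, c' w = none ↔ w ∉ p ∧ s1.comp w = none := by
    intro w
    by_cases hw : w ∈ p
    · simp [hc'p w hw, hw]
    · simp [hc'n w hw, hw]
  have hc'some : ∀ w, c' w = some s.next ↔ w ∈ p := by
    intro w
    by_cases hw : w ∈ p
    · simp [hc'p w hw, hw]
    · simp [hc'n w hw, hw, hfresh]
  have hdisj : ∀ w ∈ p, ∀ x, s1.comp x ≠ none → ¬ Path adj x w := fun w hw x hx hxw =>
    hi.comp_of_path hxw hx (hpst w hw).2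
  have hnd' := hnd
  rw [hst', List.nodup_append] at hnd'
  have hw8 := weight_complete (nodes := nodes) (adj := adj) (s := s1)
    (s' := { s1 with stack := rest, comp := c', sccs := p :: s1.sccs }) hnd'.1
    (fun w hw => hi.mem_nodes w (hpst w hw).1) (fun w hw => (hpst w hw).2) rfl
    (n := s.next) (fun w => rfl)
  rw [hval]
  refine ⟨⟨?_, ?_, h.num, le_rfl, ⟨v, hvnum, .refl, fun hlt => absurd hlt (lt_irrefl _)⟩, ?_⟩, ?_⟩
  · constructor
    · exact hi.num_lt
    · exact hi.num_inj
    · exact hi.mem_nodes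
    · intro w
      show w ∈ rest ↔ s1.num w ≠ none ∧ c' w = none
      rw [hc'none]
      constructor
      · intro hw
        have hws := (hi.mem_stack w).1 ((hmemst w).2 (.inr hw))
        exact ⟨hws.1, fun hwp => hnd'.2.2 w hwp w hw rfl, hws.2⟩
      · rintro ⟨h1, h2, h3⟩
        exact ((hmemst w).1 ((hi.mem_stack w).2 ⟨h1, h3⟩)).resolve_left h2
    · show rest.Pairwise _
      rw [hst', List.pairwise_append] at hsort
      exact hsort.2.1
    · intro w hw
      by_cases hwp : w ∈ p
      · exact (hpst w hwp).1
      · exact hi.visited_of_comp w (by rw [← hc'n w hwp]; exact hw)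
    · intro w hw
      refine ⟨(hi.gray w (.inr hw)).1, ?_⟩
      exact (hc'none w).2 ⟨hgp w hw, (hi.gray w (.inr hw)).2⟩
    · intro w hw hwg x hx
      by_cases hwv : w = v
      · subst hwv; exact (hscan x hx).1
      · exact hi.closed_num w hw (by simp [hwv, hwg]) x hx
    · intro w hw x hx hcx
      have hcx' := (hc'none x).1 hcx
      have hw' : w ∈ p ∨ s1.comp w ≠ none := by
        by_cases hwp : w ∈ p
        · exact .inl hwp
        · exact .inr (by rw [← hc'n w hwp]; exact hw)
      rcases hclosed' w x (.single hx) hw' with h1 | h1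
      · exact hcx'.1 h1
      · exact h1 hcx'.2
    · intro x hx m y k hm hk hc hmk
      exact hi.reach_of_gray x (.inr hx) m y k hm hk ((hc'none y).1 hc).2 hmk
    · intro y k hk hc
      have hc2 := (hc'none y).1 hc
      obtain ⟨x, hx, m, hmk, hm, hpath⟩ := hi.reach_gray y k hk hc2.2
      rcases hx with rfl | hx
      · rw [hvnum] at hm
        simp only [Option.some.injEq] at hm
        exact absurd (hmemp y k hk hc2.2 (by omega)) hc2.1
      · exact ⟨x, hx, m, hmk, hm, hpath⟩
    · intro w k hk
      by_cases hwp : w ∈ p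
      · have : c' w = some k := hk
        rw [hc'p w hwp] at this
        simp only [Option.some.injEq] at this
        subst this
        exact ⟨v, hvnum, hc'p v hvp⟩
      · have hk' : s1.comp w = some k := by rw [← hc'n w hwp]; exact hk
        obtain ⟨x, hx1, hx2⟩ := hi.root w k hk'
        refine ⟨x, hx1, ?_⟩
        show c' x = some k
        rw [hc'old x (by simp [hx2]), hx2]
    · intro w x hw hx
      show c' w = c' x ↔ _
      have aux : ∀ y, c' y ≠ none → y ∉ p → s1.comp y ≠ none := fun y hy hyp => by
        rwa [hc'n y hyp] at hy
      by_cases hwp : w ∈ p <;> by_cases hxp : x ∈ p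
      · rw [hc'p w hwp, hc'p x hxp]
        simp only [true_iff]
        exact ⟨(hmut w hwp).2.trans (hmut x hxp).1, (hmut x hxp).2.trans (hmut w hwp).1⟩
      · rw [hc'p w hwp, hc'n x hxp]
        exact ⟨fun hh => absurd hh.symm (hfresh x),
          fun hh => absurd hh.2 (hdisj w hwp x (aux x hx hxp))⟩
      · rw [hc'p x hxp, hc'n w hwp]
        exact ⟨fun hh => absurd hh (hfresh w),
          fun hh => absurd hh.1 (hdisj x hxp w (aux w hw hwp))⟩
      · rw [hc'n x hxp, hc'n w hwp]
        exact hi.comp_iff w x (aux w hw hwp) (aux x hx hxp)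
    · intro S hS
      rcases List.mem_cons.1 hS with rfl | hS
      · refine ⟨v, ?_, ?_⟩
        · show c' v ≠ none
          rw [hc'p v hvp]; simp
        · intro w
          show _ ↔ c' w = c' v
          rw [hc'p v hvp, hc'some]
      · obtain ⟨x, hx, hS'⟩ := hi.sccs S hS
        refine ⟨x, ?_, ?_⟩
        · show c' x ≠ none
          rwa [hc'old x hx]
        · intro w
          show _ ↔ c' w = c' x
          rw [hc'old x hx, hS']
          by_cases hwp : w ∈ p
          · rw [hc'p w hwp, (hpst w hwp).2]
            exact ⟨fun hh => absurd hh.symm hx, fun hh => absurd hh.symm (hfresh x)⟩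
          · rw [hc'n w hwp]
    · intro w hw
      by_cases hwp : w ∈ p
      · exact ⟨p, by simp, hwp⟩
      · obtain ⟨S, hS, hwS⟩ := hi.cover w (by rw [← hc'n w hwp]; exact hw)
        exact ⟨S, by simp [hS], hwS⟩
    · show (p :: s1.sccs).flatten.Nodup
      rw [List.flatten_cons, List.nodup_append]
      refine ⟨hnd'.1, hi.nodup, ?_⟩
      rintro a ha b hb rfl
      obtain ⟨S, hS, haS⟩ := List.mem_flatten.1 hb
      obtain ⟨x, hx, hS'⟩ := hi.sccs S hS
      exact hx (by rw [← (hS' a).1 haS, (hpst a ha).2])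
  · refine ⟨h.ext.next_le, h.ext.num, ?_, h.ext.new⟩
    intro w hw
    show c' w = _
    rw [hc'n w (hold w hw)]
    exact h.ext.comp w hw
  · intro a ha1 ha2 ha3 b hb m hm hmc
    exfalso
    obtain ⟨k, hk⟩ := Option.ne_none_iff_exists'.1 ha2
    have ha3' := (hc'none a).1 ha3
    exact ha3'.1 (hmemp a k hk ha3'.2 (h.ext.new a k ha1 hk))
  · simp only
    rw [hw8]; omega

end Tarjan

/-! ### Correctness and linear cost of the recursion. -/

section Tarjan

set_option linter.unusedSectionVars false

variable {V : Type} [DecidableEq V]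

/-- The depth only has to bound the number of unvisited nodes, which drops with every nested call,
so depth zero is never reached. The cost is charged to the growth of the potential `weight`. -/
theorem visit_spec {nodes : Finset V} {adj : V → List V}
    (hadj : ∀ v ∈ nodes, ∀ w ∈ adj v, w ∈ nodes) (depth : ℕ) :
    ∀ (g : Set V) (v : V) (s : TarjanState V), TarjanInv nodes adj g s → v ∈ nodes →
      s.num v = none → (∀ x ∈ g, Path adj x v) →
      (nodes.filter fun a => s.num a = none).card ≤ depth →
      Visited nodes adj g v s (visit adj depth v s).val ∧
      weight nodes adj s + (visit adj depth v s).steps ≤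
        weight nodes adj (visit adj depth v s).val.1 := by
  induction depth with
  | zero =>
    intro g v s _ hv hs _ hd
    exfalso
    have : v ∈ nodes.filter fun a => s.num a = none := Finset.mem_filter.2 ⟨hv, hs⟩
    simp only [Nat.le_zero, Finset.card_eq_zero] at hd
    simp [hd] at this
  | succ depth hrec =>
    intro g v s h hv hs hg hd
    have hgs : ∀ x ∈ g, s.num x ≠ none := fun x hx => (h.gray x hx).1
    have hvg : v ∉ g := fun hvg => hgs v hvg hs
    have hloop : ∀ (l : List V) (r : TarjanState V × ℕ), (∀ w ∈ l, w ∈ adj v) →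
        VisitInv nodes adj g v s r →
        VisitInv nodes adj g v s (loop (visitEdge adj depth) r l).val ∧
        (∀ w ∈ l, Scanned (loop (visitEdge adj depth) r l).val w) ∧
        (∀ w, Scanned r w → Scanned (loop (visitEdge adj depth) r l).val w) ∧
        weight nodes adj r.1 + (loop (visitEdge adj depth) r l).steps ≤
          weight nodes adj (loop (visitEdge adj depth) r l).val.1 + l.length + 1 := by
      intro l
      induction l with
      | nil => intro r _ hr; exact ⟨hr, by simp, fun w hw => hw, by simp⟩
      | cons a l ih =>
        intro r hl hr
        have ha := hl a (by simp)
        obtain ⟨h1, h2, h3, h4⟩ := hr.visitEdge hrec hg hgs hd hs ha (hadj v hv a ha)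
        obtain ⟨k1, k2, k3, k4⟩ := ih _ (fun w hw => hl w (by simp [hw])) h1
        rw [loop_cons_val, loop_cons_steps]
        refine ⟨k1, ?_, fun w hw => k3 w (h3 w hw), ?_⟩
        · intro w hw
          rcases List.mem_cons.1 hw with rfl | hw
          · exact k3 _ h2
          · exact k2 w hw
        · rw [List.length_cons]; omega
    obtain ⟨h1, h2, -, h4⟩ := hloop (adj v) (s.push v, s.next) (fun w hw => hw)
      (VisitInv.push h hv hs hg)
    rw [visit_succ]
    simp only [val_bind, steps_bind, steps_tick]
    set r := (loop (visitEdge adj depth) (s.push v, s.next) (adj v)).val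
    have hw := weight_push (adj := adj) hv hs
    by_cases heq : r.2 = s.next
    · obtain ⟨k1, k2⟩ := h1.finish_of_eq h hs h2 heq
      exact ⟨k1, by simp only at h4; omega⟩
    · have hfin : finish v s.next r = pure r := by simp [finish, heq]
      rw [hfin]
      exact ⟨h1.visited_of_lt h2 (lt_of_le_of_ne h1.low_le heq) hvg, by
        simp only [val_pure, steps_pure] at h4 ⊢; omega⟩

theorem TarjanInv.empty (nodes : Finset V) (adj : V → List V) :
    TarjanInv nodes adj ∅ (TarjanState.empty V) := by
  constructor <;> simp [TarjanState.empty]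

theorem weight_le (nodes : Finset V) (adj : V → List V) (s : TarjanState V) :
    weight nodes adj s ≤ 5 * nodes.card + ∑ a ∈ nodes, (adj a).length := by
  have h1 : (∑ a ∈ nodes, if s.num a = none then 0 else 3 + (adj a).length) ≤
      ∑ a ∈ nodes, (3 + (adj a).length) :=
    Finset.sum_le_sum fun a _ => by split_ifs <;> simp
  have h2 : (∑ a ∈ nodes, if s.comp a = none then 0 else 1) ≤ ∑ a ∈ nodes, 1 :=
    Finset.sum_le_sum fun a _ => by split_ifs <;> simp
  simp only [Finset.sum_add_distrib, Finset.sum_const, smul_eq_mul] at h1 h2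
  unfold weight
  omega

/-- Tarjan's algorithm finds the strongly connected components in linear time. -/
theorem tarjan_spec {nodes : Finset V} {adj : V → List V}
    (hadj : ∀ v ∈ nodes, ∀ w ∈ adj v, w ∈ nodes) :
    TarjanInv nodes adj ∅ (tarjan nodes adj).val ∧
    (∀ v, (tarjan nodes adj).val.comp v ≠ none ↔ v ∈ nodes) ∧
    (tarjan nodes adj).steps ≤ 6 * nodes.card + ∑ a ∈ nodes, (adj a).length + 1 := by
  have hloop : ∀ (l : List V) (s : TarjanState V), (∀ w ∈ l, w ∈ nodes) →
      TarjanInv nodes adj ∅ s →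
      ∃ r : Timed (TarjanState V), r = loop (fun (s : TarjanState V) v =>
        match s.num v with
        | none => do
          let r ← visit adj nodes.card v s
          pure r.1
        | some _ => pure s) s l ∧ TarjanInv nodes adj ∅ r.val ∧ TarjanExt s r.val ∧
      (∀ w ∈ l, r.val.num w ≠ none) ∧
      weight nodes adj s + r.steps ≤ weight nodes adj r.val + l.length + 1 := by
    intro l
    induction l with
    | nil => intro s _ hs; exact ⟨_, rfl, hs, .refl s, by simp, by simp⟩
    | cons a l ih =>
      intro s hl hs
      refine ⟨_, rfl, ?_⟩
      rw [loop_cons_val, loop_cons_steps, List.length_cons]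
      cases hnum : s.num a with
      | none =>
        obtain ⟨h1, h2⟩ := visit_spec hadj nodes.card ∅ a s hs (hl a (by simp)) hnum (by simp)
          (Finset.card_filter_le _ _)
        obtain ⟨r, hr, k1, k2, k3, k4⟩ := ih (visit adj nodes.card a s).val.1
          (fun w hw => hl w (by simp [hw])) h1.inv
        simp only [val_bind, steps_bind, val_pure, steps_pure]
        rw [← hr]
        refine ⟨k1, h1.ext.trans k2, ?_, by omega⟩
        intro w hw
        rcases List.mem_cons.1 hw with rfl | hw
        · rw [k2.num _ _ h1.num]; simp
        · exact k3 w hw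
      | some m =>
        obtain ⟨r, hr, k1, k2, k3, k4⟩ := ih s (fun w hw => hl w (by simp [hw])) hs
        simp only [val_pure, steps_pure]
        rw [← hr]
        refine ⟨k1, k2, ?_, by omega⟩
        intro w hw
        rcases List.mem_cons.1 hw with rfl | hw
        · rw [k2.num _ _ hnum]; simp
        · exact k3 w hw
  obtain ⟨r, hr, h1, -, h3, h4⟩ := hloop nodes.toList (TarjanState.empty V) (by simp)
    (TarjanInv.empty nodes adj)
  have hr' : tarjan nodes adj = r := hr.symm
  rw [hr']
  refine ⟨h1, fun v => ⟨fun hv => h1.mem_nodes v (h1.visited_of_comp v hv), fun hv hc => ?_⟩, ?_⟩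
  · obtain ⟨k, hk⟩ := Option.ne_none_iff_exists'.1 (h3 v (by simpa using hv))
    -- With no call running, an open visited node would reach an element of `∅`.
    obtain ⟨x, hx, -⟩ := h1.reach_gray v k hk hc
    exact hx
  · have := weight_le nodes adj r.val
    rw [Finset.length_toList] at h4
    omega

end Tarjan

/-! ### The local programs that compute components and representatives -/

section Classify

/-- `v` is the smallest node of a component that no edge enters. -/
def IsSrc {V : Type} [LinearOrder V] (F : Finset (V × V)) (v : V) : Prop :=
  ∀ w, Reach F w v → Reach F v w ∧ v ≤ w

/-- `v` is the smallest node of a component that no edge leaves. -/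
def IsTgt {V : Type} [LinearOrder V] (F : Finset (V × V)) (v : V) : Prop :=
  ∀ w, Reach F v w → Reach F w v ∧ v ≤ w

open Classical in
/-- The edges that lie on a path to `u`. -/
noncomputable def knownEdges {V : Type} (F : Finset (V × V)) (u : V) : Finset (V × V) :=
  F.filter fun e => Reach F e.1 u

variable {V : Type}

theorem mem_knownEdges {F : Finset (V × V)} {u : V} {e : V × V} :
    e ∈ knownEdges F u ↔ e ∈ F ∧ Reach F e.1 u := by simp [knownEdges]

theorem Reach.mono {F F' : Finset (V × V)} (h : F ⊆ F') {u v : V} (huv : Reach F u v) :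
    Reach F' u v :=
  Relation.ReflTransGen.mono (fun _ _ hab => h hab) _ _ huv

/-- All edges of a path to `b` start at nodes that reach `b`, hence `u`, so the whole path is known
to `u`. -/
theorem reach_knownEdges {F : Finset (V × V)} {u b : V} (hb : Reach F b u) (a : V) :
    Reach (knownEdges F u) a b ↔ Reach F a b := by
  refine ⟨Reach.mono fun e he => (mem_knownEdges.1 he).1, fun h => ?_⟩
  induction h using Relation.ReflTransGen.head_induction_on with
  | refl => exact .refl
  | head hac hcb ih =>
    refine .head ?_ ih
    exact mem_knownEdges.2 ⟨hac, .head hac (Relation.ReflTransGen.trans hcb hb)⟩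

/-- A path that enters a set has an edge that enters it. -/
theorem Reach.exists_edge {F : Finset (V × V)} {a b : V} (h : Reach F a b) {p : V → Prop}
    (ha : ¬ p a) (hb : p b) : ∃ e ∈ F, ¬ p e.1 ∧ p e.2 ∧ Reach F a e.1 ∧ Reach F e.2 b := by
  induction h with
  | refl => exact absurd hb ha
  | @tail c d hac hcd ih =>
    by_cases hc : p c
    · obtain ⟨e, he, h1, h2, h3, h4⟩ := ih hc
      exact ⟨e, he, h1, h2, h3, Relation.ReflTransGen.tail h4 hcd⟩
    · exact ⟨(c, d), hcd, hc, hb, hac, .refl⟩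

section Loops

variable [DecidableEq V]

/-- The body of the loop that builds the adjacency lists. -/
def addEdge (g : Finset V × (V → List V)) (e : V × V) : Timed (Finset V × (V → List V)) :=
  pure (insert e.1 (insert e.2 g.1), Function.update g.2 e.1 (e.2 :: g.2 e.1))

theorem loop_addEdge_fst (g : Finset V × (V → List V)) (l : List (V × V)) (w : V) :
    w ∈ (loop addEdge g l).val.1 ↔ w ∈ g.1 ∨ ∃ e ∈ l, w = e.1 ∨ w = e.2 := by
  induction l generalizing g with
  | nil => simp
  | cons e l ih =>
    rw [loop_cons_val, ih]
    simp only [addEdge, val_pure, Finset.mem_insert, List.mem_cons, exists_eq_or_imp]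
    simp only [or_assoc, or_left_comm]

theorem loop_addEdge_snd (g : Finset V × (V → List V)) (l : List (V × V)) (a b : V) :
    b ∈ (loop addEdge g l).val.2 a ↔ b ∈ g.2 a ∨ (a, b) ∈ l := by
  induction l generalizing g with
  | nil => simp
  | cons e l ih =>
    rw [loop_cons_val, ih]
    simp only [addEdge, val_pure, List.mem_cons]
    obtain ⟨x, y⟩ := e
    by_cases hx : a = x
    · subst hx
      simp only [Function.update_self, List.mem_cons, Prod.mk.injEq, true_and]
      tauto
    · simp [hx]

theorem loop_addEdge_length (nodes : Finset V) (g : Finset V × (V → List V)) (l : List (V × V)) :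
    ∑ a ∈ nodes, ((loop addEdge g l).val.2 a).length ≤
      ∑ a ∈ nodes, (g.2 a).length + l.length := by
  induction l generalizing g with
  | nil => simp
  | cons e l ih =>
    rw [loop_cons_val, List.length_cons]
    refine (ih _).trans ?_
    have : ∑ a ∈ nodes, ((addEdge g e).val.2 a).length ≤
        ∑ a ∈ nodes, ((g.2 a).length + if a = e.1 then 1 else 0) := by
      refine Finset.sum_le_sum fun a _ => ?_
      by_cases ha : a = e.1
      · subst ha; simp [addEdge]
      · simp [addEdge, ha]
    rw [Finset.sum_add_distrib, Finset.sum_ite_eq'] at this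
    split_ifs at this <;> omega

end Loops

variable [LinearOrder V]

theorem le_loop_min_iff (p : V → Prop) [DecidablePred p] (b : V) (l : List V) (x : V) :
    x ≤ (loop (fun (m w : V) => pure (if p w then min m w else m)) b l).val ↔
      x ≤ b ∧ ∀ w ∈ l, p w → x ≤ w := by
  induction l generalizing b with
  | nil => simp
  | cons a l ih =>
    rw [loop_cons_val, ih, val_pure]
    by_cases ha : p a
    · simp [ha, and_assoc]
    · simp [ha]

theorem smallest_steps (l : List V) : (smallest l).steps ≤ l.length + 1 := by
  have := loop_steps_le_const (fun (m : Option V) w =>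
      match m with
      | none => pure (some w)
      | some x => pure (some (min x w))) 0 l (fun b a _ => by cases b <;> simp) none
  rw [zero_add, one_mul] at this
  exact this

theorem smallest_val (l : List V) (s : V) :
    (smallest l).val = some s ↔ s ∈ l ∧ ∀ w ∈ l, s ≤ w := by
  have aux : ∀ (l : List V) (x : V), ∃ y, (loop (fun (m : Option V) w =>
      match m with
      | none => pure (some w)
      | some x => pure (some (min x w))) (some x) l).val = some y ∧ y ∈ x :: l ∧
        ∀ w ∈ x :: l, y ≤ w := by
    intro l
    induction l with
    | nil => intro x; exact ⟨x, by simp⟩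
    | cons a l ih =>
      intro x
      obtain ⟨y, h1, h2, h3⟩ := ih (min x a)
      refine ⟨y, h1, ?_, ?_⟩
      · rcases List.mem_cons.1 h2 with rfl | h2
        · rcases min_choice x a with h | h <;> simp [h]
        · simp [h2]
      · have hmin := h3 (min x a) (by simp)
        intro w hw
        simp only [List.mem_cons] at hw
        rcases hw with rfl | rfl | hw
        · exact hmin.trans (min_le_left _ _)
        · exact hmin.trans (min_le_right _ _)
        · exact h3 w (by simp [hw])
  cases l with
  | nil => simp [smallest]
  | cons a l =>
    obtain ⟨y, h1, h2, h3⟩ := aux l a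
    have h1' : (smallest (a :: l)).val = some y := h1
    rw [h1', Option.some.injEq]
    constructor
    · rintro rfl; exact ⟨h2, h3⟩
    · rintro ⟨h4, h5⟩
      exact le_antisymm (h3 s h4) (h5 y h2)

/-- `s` describes the components of the digraph of the edges known to `u`. -/
structure Components (F : Finset (V × V)) (u : V) (s : TarjanState V) : Prop where
  comp_ne_none : ∀ w, s.comp w ≠ none ↔ w = u ∨ ∃ e ∈ knownEdges F u, w = e.1 ∨ w = e.2
  comp_iff : ∀ v w, s.comp v ≠ none → s.comp w ≠ none →
    (s.comp v = s.comp w ↔ Reach (knownEdges F u) v w ∧ Reach (knownEdges F u) w v)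
  sccs : ∀ S ∈ s.sccs, ∃ v, s.comp v ≠ none ∧ ∀ w, w ∈ S ↔ s.comp w = s.comp v
  cover : ∀ v, s.comp v ≠ none → ∃ S ∈ s.sccs, v ∈ S
  nodup : s.sccs.flatten.Nodup

omit [LinearOrder V] in
theorem Components.ne_none {F : Finset (V × V)} {u : V} {s : TarjanState V}
    (h : Components F u s) {x : V} (hx : Reach F x u) : s.comp x ≠ none := by
  rw [h.comp_ne_none]
  rcases Relation.ReflTransGen.cases_head hx with rfl | ⟨c, hc, _⟩
  · exact .inl rfl
  · exact .inr ⟨(x, c), mem_knownEdges.2 ⟨hc, hx⟩, .inl rfl⟩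

omit [LinearOrder V] in
/-- The components of the nodes that reach `u` are those of the whole digraph. -/
theorem Components.comp_eq_iff {F : Finset (V × V)} {u : V} {s : TarjanState V}
    (h : Components F u s) {x y : V} (hy : Reach F y u) :
    s.comp x = s.comp y ↔ Reach F x y ∧ Reach F y x := by
  constructor
  · intro hxy
    have hx : s.comp x ≠ none := hxy ▸ h.ne_none hy
    obtain ⟨h1, h2⟩ := (h.comp_iff x y hx (h.ne_none hy)).1 hxy
    rw [reach_knownEdges hy] at h1
    rw [reach_knownEdges (Relation.ReflTransGen.trans h1 hy)] at h2
    exact ⟨h1, h2⟩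
  · rintro ⟨h1, h2⟩
    have hx : Reach F x u := Relation.ReflTransGen.trans h1 hy
    rw [h.comp_iff x y (h.ne_none hx) (h.ne_none hy), reach_knownEdges hy, reach_knownEdges hx]
    exact ⟨h1, h2⟩

open Classical in
-- Every edge that enters or leaves the component of `u` starts at a node that reaches `u`, so it is
-- known. The classification is therefore correct for `F`, although only a part of `F` is seen.
theorem classify_spec [Fintype V] (F : Finset (V × V)) (u : V) (a : Agent V)
    (ha : a.known = knownEdges F u) :
    ∃ (s : TarjanState V) (role : Role),
      (classify u a).val = ({ a with role := role, scc := s }, ∅) ∧ Components F u s ∧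
      role = (if (∀ w, Reach F w u ↔ Reach F u w) then .exited
        else if IsSrc F u then .source else if IsTgt F u then .target else .idle) ∧
      (classify u a).steps ≤ 4 * F.card + 7 * Fintype.card V + 6 := by
  set g := (loop addEdge ({u}, fun _ => []) a.known.toList).val with hg
  have hg1 : ∀ w, w ∈ g.1 ↔ w = u ∨ ∃ e ∈ knownEdges F u, w = e.1 ∨ w = e.2 := by
    intro w
    rw [hg, loop_addEdge_fst, ha]
    simp
  have hg2 : ∀ a b, b ∈ g.2 a ↔ (a, b) ∈ knownEdges F u := by
    intro x y
    rw [hg, loop_addEdge_snd, ha]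
    simp
  have hcardK : a.known.card ≤ F.card := by
    rw [ha]; exact Finset.card_le_card fun e he => (mem_knownEdges.1 he).1
  have hlen : ∑ a ∈ g.1, (g.2 a).length ≤ a.known.card := by
    refine (loop_addEdge_length g.1 _ _).trans ?_
    simp
  obtain ⟨hinv, hcomp, hsteps⟩ := tarjan_spec (nodes := g.1) (adj := g.2) (by
    intro v _ w hw
    rw [hg2] at hw
    exact (hg1 w).2 (.inr ⟨_, hw, .inr rfl⟩))
  set s := (tarjan g.1 g.2).val with hs
  have hpath : ∀ x y, Path g.2 x y ↔ Reach (knownEdges F u) x y := by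
    intro x y
    unfold Path Reach
    simp only [hg2]
  have hC : Components F u s :=
    ⟨fun w => by rw [hcomp, hg1], fun v w hv hw => by
      rw [hinv.comp_iff v w hv hw, hpath, hpath], hinv.sccs, hinv.cover, hinv.nodup⟩
  have hcu : ∀ x, s.comp x = s.comp u ↔ Reach F x u ∧ Reach F u x :=
    fun x => hC.comp_eq_iff .refl
  set hasIn := loop (fun (b : Bool) (e : V × V) =>
      pure (b || (decide (s.comp e.1 ≠ s.comp u) && decide (s.comp e.2 = s.comp u))))
    false a.known.toList with hIn
  set hasOut := loop (fun (b : Bool) (e : V × V) =>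
      pure (b || (decide (s.comp e.1 = s.comp u) && decide (s.comp e.2 ≠ s.comp u))))
    false a.known.toList with hOut
  set rep := loop (fun (m w : V) => pure (if s.comp w = s.comp u then min m w else m)) u
    g.1.toList with hrep
  have hInF : hasIn.val = false ↔ ∀ w, Reach F w u → Reach F u w := by
    rw [← Bool.not_eq_true, hIn, loop_or _ _ fun _ _ => rfl]
    simp only [Bool.false_eq_true, false_or, Bool.and_eq_true, decide_eq_true_eq, Finset.mem_toList,
      ha, mem_knownEdges, ne_eq, hcu, not_exists, not_and]
    constructor
    · intro h w hwu
      by_contra hc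
      -- The path from `w` to `u` must enter the set of nodes reached from `u`; the edge on which it
      -- does so enters the component of `u`.
      obtain ⟨e, he, h1, h2, h3, h4⟩ := hwu.exists_edge (p := fun x => Reach F u x) hc .refl
      have h5 : Reach F e.1 u := .head he h4
      exact h e ⟨he, h5⟩ (fun _ => h1) h4 h2
    · intro h e he h1 h2 _
      exact h1 he.2 (h _ he.2)
  have hOutF : hasOut.val = false ↔ ∀ w, Reach F u w → Reach F w u := by
    rw [← Bool.not_eq_true, hOut, loop_or _ _ fun _ _ => rfl]
    simp only [Bool.false_eq_true, false_or, Bool.and_eq_true, decide_eq_true_eq, Finset.mem_toList,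
      ha, mem_knownEdges, ne_eq, hcu, not_exists, not_and]
    constructor
    · intro h w huw
      by_contra hc
      obtain ⟨e, he, h1, h2, h3, h4⟩ := huw.exists_edge (p := fun x => ¬ Reach F x u)
        (not_not.2 .refl) hc
      rw [not_not] at h1
      exact h e ⟨he, h1⟩ ⟨h1, h3⟩ fun h5 => absurd h5 h2
    · intro h e he h1
      have h2 : Reach F u e.2 := .tail h1.2 he.1
      exact fun h3 => h3 (h _ h2) h2
  have hrepF : u = rep.val ↔ ∀ w, Reach F w u → Reach F u w → u ≤ w := by
    have h1 : rep.val ≤ u := ((le_loop_min_iff _ u g.1.toList rep.val).1 le_rfl).1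
    have h2 : u = rep.val ↔ u ≤ rep.val := ⟨fun h => h.le, fun h => le_antisymm h h1⟩
    rw [h2, hrep, le_loop_min_iff]
    simp only [le_refl, true_and, Finset.mem_toList, hcu]
    constructor
    · intro h w hw1 hw2
      refine h w ?_ ⟨hw1, hw2⟩
      rw [← hcomp]
      exact hC.ne_none hw1
    · intro h w _ hw
      exact h w hw.1 hw.2
  have hS : hasIn.val = false ∧ u = rep.val ↔ IsSrc F u := by
    rw [hInF, hrepF]
    exact ⟨fun h w hw => ⟨h.1 w hw, h.2 w hw (h.1 w hw)⟩,
      fun h => ⟨fun w hw => (h w hw).1, fun w hw _ => (h w hw).2⟩⟩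
  have hT : hasOut.val = false ∧ u = rep.val ↔ IsTgt F u := by
    rw [hOutF, hrepF]
    exact ⟨fun h w hw => ⟨h.1 w hw, h.2 w (h.1 w hw) hw⟩,
      fun h => ⟨fun w hw => (h w hw).1, fun w _ hw => (h w hw).2⟩⟩
  have hX : hasIn.val = false ∧ hasOut.val = false ↔ ∀ w, Reach F w u ↔ Reach F u w := by
    rw [hInF, hOutF]
    exact ⟨fun h w => ⟨h.1 w, h.2 w⟩, fun h => ⟨fun w => (h w).1, fun w => (h w).2⟩⟩
  have hcardV : g.1.card ≤ Fintype.card V := Finset.card_le_univ _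
  refine ⟨s, if hasIn.val = false ∧ hasOut.val = false then .exited
    else if hasIn.val = false ∧ u = rep.val then .source
    else if hasOut.val = false ∧ u = rep.val then .target
    else .idle, rfl, hC, ?_, ?_⟩
  · simp only [hX, hS, hT]
  · have e1 := loop_steps_le_const addEdge 0 a.known.toList (fun _ _ _ => le_rfl)
      ({u}, fun _ => [])
    have e2 := loop_steps_le_const (fun (b : Bool) (e : V × V) =>
      pure (b || (decide (s.comp e.1 ≠ s.comp u) && decide (s.comp e.2 = s.comp u)))) 0
      a.known.toList (fun _ _ _ => le_rfl) false
    have e3 := loop_steps_le_const (fun (b : Bool) (e : V × V) =>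
      pure (b || (decide (s.comp e.1 = s.comp u) && decide (s.comp e.2 ≠ s.comp u)))) 0
      a.known.toList (fun _ _ _ => le_rfl) false
    have e4 := loop_steps_le_const (fun (m w : V) =>
      pure (if s.comp w = s.comp u then min m w else m)) 0 g.1.toList (fun _ _ _ => le_rfl) u
    have e : (classify u a).steps = 1 + ((loop addEdge ({u}, fun _ => []) a.known.toList).steps +
      ((tarjan g.1 g.2).steps + (hasIn.steps + (hasOut.steps + (rep.steps + 0))))) := rfl
    rw [← hIn] at e2
    rw [← hOut] at e3
    rw [← hrep] at e4
    rw [Finset.length_toList] at e1 e2 e3 e4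
    rw [e]
    omega

/-- The representative of a target component sends to the representatives of the source components
that reach it. -/
theorem phase2_spec [Fintype V] (F : Finset (V × V)) (u : V) (a : Agent V)
    (ha : a.known = knownEdges F u) (hs : Components F u a.scc) (hrole : a.role = .target) :
    ∃ R : Finset V, (phase2 a).val = ({ a with offer := R }, ∅) ∧
      (∀ s, s ∈ R ↔ IsSrc F s ∧ Reach F s u) ∧
      (phase2 a).steps ≤ F.card + 5 * Fintype.card V + Fintype.card V * Fintype.card V + 4 := by
  set entered := loop (fun (h : Finset (Option ℕ)) (e : V × V) =>
        if a.scc.comp e.1 ≠ a.scc.comp e.2 then pure (insert (a.scc.comp e.2) h) else pure h)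
      ∅ a.known.toList with hent
  set reps := loop (fun (R : Finset V) (S : List V) => do
        let m ← smallest S
        match m with
        | none => pure R
        | some s => if a.scc.comp s ∈ entered.val then pure R else pure (insert s R))
      ∅ a.scc.sccs with hreps
  have hentF : ∀ c, c ∈ entered.val ↔
      ∃ e ∈ knownEdges F u, a.scc.comp e.1 ≠ a.scc.comp e.2 ∧ a.scc.comp e.2 = c := by
    intro c
    rw [hent, mem_loop_insert (fun e : V × V => a.scc.comp e.1 ≠ a.scc.comp e.2)
      (fun e => a.scc.comp e.2) _ (fun F e => by split_ifs <;> rfl)]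
    simp [ha]
  have hrepsF : ∀ s, s ∈ reps.val ↔
      ∃ S ∈ a.scc.sccs, (smallest S).val = some s ∧ a.scc.comp s ∉ entered.val := by
    intro s
    rw [hreps]
    generalize a.scc.sccs = l
    suffices h : ∀ R : Finset V, s ∈ (loop (fun (R : Finset V) (S : List V) => do
        let m ← smallest S
        match m with
        | none => pure R
        | some s => if a.scc.comp s ∈ entered.val then pure R else pure (insert s R))
        R l).val ↔ s ∈ R ∨
          ∃ S ∈ l, (smallest S).val = some s ∧ a.scc.comp s ∉ entered.val by
      rw [h]; simp
    induction l with
    | nil => simp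
    | cons S l ih =>
      intro R
      rw [loop_cons_val, ih]
      simp only [val_bind, List.mem_cons, exists_eq_or_imp]
      cases hS : (smallest S).val with
      | none => simp
      | some x =>
        by_cases hx : a.scc.comp x ∈ entered.val
        · simp only [hx, if_true, val_pure, Option.some.injEq]
          constructor
          · tauto
          · rintro (h | ⟨rfl, h⟩ | h)
            · exact .inl h
            · exact absurd hx h
            · exact .inr h
        · simp only [hx, if_false, val_pure, Option.some.injEq, Finset.mem_insert]
          constructor
          · rintro ((rfl | h) | h)
            · exact .inr (.inl ⟨rfl, hx⟩)
            · exact .inl h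
            · exact .inr (.inr h)
          · rintro (h | ⟨rfl, h⟩ | h)
            · exact .inl (.inr h)
            · exact .inl (.inl rfl)
            · exact .inr h
  refine ⟨reps.val, by unfold phase2; simp only [hrole, if_true, val_bind]; rfl, ?_, ?_⟩
  · intro s
    rw [hrepsF]
    constructor
    · rintro ⟨S, hS, hsm, hnent⟩
      rw [smallest_val] at hsm
      rw [hentF] at hnent
      obtain ⟨v, hv, hSv⟩ := hs.sccs S hS
      have hsv := (hSv s).1 hsm.1
      have hsn : a.scc.comp s ≠ none := hsv ▸ hv
      -- Known edges may have heads that do not reach `u`, and these form spurious components. None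
      -- of them passes the test: it is entered by such an edge, whose tail reaches `u` and thus
      -- lies in another component.
      have hsu : Reach F s u := by
        by_contra hsu
        rcases (hs.comp_ne_none s).1 hsn with rfl | ⟨e, he, rfl | rfl⟩
        · exact hsu .refl
        · exact hsu (mem_knownEdges.1 he).2
        · refine hnent ⟨e, he, fun hee => ?_, rfl⟩
          have := (hs.comp_eq_iff (mem_knownEdges.1 he).2).1 hee.symm
          exact hsu (Relation.ReflTransGen.trans this.1 (mem_knownEdges.1 he).2)
      refine ⟨fun w hw => ?_, hsu⟩
      have hsw : Reach F s w := by
        by_contra hc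
        obtain ⟨e, he, h1, h2, h3, h4⟩ := hw.exists_edge (p := fun x => Reach F s x) hc .refl
        have h5 : Reach F e.1 u := .head he (Relation.ReflTransGen.trans h4 hsu)
        have h6 : Reach F e.2 u := Relation.ReflTransGen.trans h4 hsu
        refine hnent ⟨e, mem_knownEdges.2 ⟨he, h5⟩, fun hee => ?_,
          (hs.comp_eq_iff hsu).2 ⟨h4, h2⟩⟩
        exact h1 (Relation.ReflTransGen.trans h2 ((hs.comp_eq_iff h6).1 hee).2)
      refine ⟨hsw, hsm.2 w ((hSv w).2 ?_)⟩
      rw [← hsv]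
      exact (hs.comp_eq_iff hsu).2 ⟨hw, hsw⟩
    · rintro ⟨hsrc, hsu⟩
      have hsn := hs.ne_none hsu
      obtain ⟨S, hS, hsS⟩ := hs.cover s hsn
      obtain ⟨v, hv, hSv⟩ := hs.sccs S hS
      have hsv := (hSv s).1 hsS
      refine ⟨S, hS, (smallest_val S s).2 ⟨hsS, fun w hw => ?_⟩, ?_⟩
      · have := (hSv w).1 hw
        rw [← hsv] at this
        exact (hsrc w ((hs.comp_eq_iff hsu).1 this).1).2
      · rw [hentF]
        rintro ⟨e, he, h1, h2⟩
        have h3 := (hs.comp_eq_iff hsu).1 h2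
        have h4 : Reach F e.1 s := .head (mem_knownEdges.1 he).1 h3.1
        apply h1
        rw [h2]
        exact (hs.comp_eq_iff hsu).2 ⟨h4, (hsrc _ h4).1⟩
  · have e1 := loop_steps_le_const (fun (h : Finset (Option ℕ)) (e : V × V) =>
        if a.scc.comp e.1 ≠ a.scc.comp e.2 then pure (insert (a.scc.comp e.2) h) else pure h) 0
      a.known.toList (fun h e _ => by split_ifs <;> simp) ∅
    have e2 := loop_steps_le (fun (R : Finset V) (S : List V) => do
        let m ← smallest S
        match m with
        | none => pure R
        | some s => if a.scc.comp s ∈ entered.val then pure R else pure (insert s R))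
      (fun S => S.length + 1) a.scc.sccs (fun R S _ => by
        have := smallest_steps S
        simp only [steps_bind]
        cases (smallest S).val with
        | none => simpa using this
        | some x => by_cases hx : a.scc.comp x ∈ entered.val <;> simpa [hx] using this) ∅
    rw [← hent, Finset.length_toList] at e1
    rw [← hreps] at e2
    have hcardK : a.known.card ≤ F.card := by
      rw [ha]; exact Finset.card_le_card fun e he => (mem_knownEdges.1 he).1
    -- The listed components are nonempty and disjoint, so both their number and their total length
    -- are at most `|V|`.
    have hfl : (a.scc.sccs.map fun S => S.length + 1).sum ≤
        2 * Fintype.card V ∧ a.scc.sccs.length ≤ Fintype.card V := by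
      have h1 : a.scc.sccs.flatten.length ≤ Fintype.card V := hs.nodup.length_le_card
      rw [List.length_flatten] at h1
      have h2 : ∀ l : List (List V), (∀ S ∈ l, S ≠ []) →
          (l.map fun S => S.length + 1).sum = (l.map List.length).sum + l.length ∧
          l.length ≤ (l.map List.length).sum := by
        intro l
        induction l with
        | nil => simp
        | cons S l ih =>
          intro hl
          have := ih fun S hS => hl S (by simp [hS])
          have hS := List.length_pos_iff.2 (hl S (by simp))
          simp only [List.map_cons, List.sum_cons, List.length_cons]
          omega
      have := h2 a.scc.sccs (fun S hS => by
        obtain ⟨v, hv, hSv⟩ := hs.sccs S hS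
        rintro rfl
        exact absurd ((hSv v).2 rfl) (by simp))
      omega
    have hr : reps.val.card ≤ Fintype.card V := Finset.card_le_univ _
    have e : (phase2 a).steps = 1 + (entered.steps + (reps.steps +
        (reps.val.card * (reps.val.card + 1)))) := by
      unfold phase2
      simp only [hrole, if_true, steps_bind]
      rfl
    have hm : reps.val.card * (reps.val.card + 1) ≤
        Fintype.card V * Fintype.card V + Fintype.card V := by
      calc _ ≤ Fintype.card V * (Fintype.card V + 1) := Nat.mul_le_mul hr (by omega)
        _ = _ := by ring
    rw [e]
    omega

end Classify

/-! ### Progress made by one round -/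

section Progress

variable {V : Type}

theorem Reach.trans {F : Finset (V × V)} {u v w : V} (h : Reach F u v) (h' : Reach F v w) :
    Reach F u w :=
  Relation.ReflTransGen.trans h h'

theorem Reach.of_edge {F : Finset (V × V)} {u v : V} (h : (u, v) ∈ F) : Reach F u v := .single h

theorem WeaklyConnected.mono {F F' : Finset (V × V)} (h : F ⊆ F') (hF : WeaklyConnected F) :
    WeaklyConnected F' := fun u v =>
  Relation.ReflTransGen.mono (fun _ _ hab => hab.imp (fun k => h k) (fun k => h k)) _ _ (hF u v)

/-- The induction principle through which most arguments below use weak connectivity. -/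
theorem WeaklyConnected.forall_of_closed {F : Finset (V × V)} (h : WeaklyConnected F)
    {p : V → Prop} {a : V} (ha : p a) (hp : ∀ x y, (x, y) ∈ F → (p x ↔ p y)) (v : V) : p v := by
  induction h a v with
  | refl => exact ha
  | tail _ hbc ih =>
    rcases hbc with hbc | hbc
    · exact (hp _ _ hbc).1 ih
    · exact (hp _ _ hbc).2 ih

variable [LinearOrder V]

theorem IsSrc.eq {F : Finset (V × V)} {s s' : V} (h : IsSrc F s) (h' : IsSrc F s')
    (hr : Reach F s s') : s = s' :=
  le_antisymm (h s' (h' s hr).1).2 (h' s hr).2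

theorem IsTgt.eq {F : Finset (V × V)} {t t' : V} (h : IsTgt F t) (h' : IsTgt F t')
    (hr : Reach F t t') : t = t' :=
  le_antisymm (h t' hr).2 (h' t (h t' hr).1).2

/-- Among the elements below `v` take `w` with the fewest predecessors. A predecessor of `w` cannot
have fewer, so it has the same ones, among them `w` itself; hence the predecessors of `w` form its
class, and `s` is the least of them. The relation is left abstract so that its reversal yields
targets. -/
theorem exists_minimal_of_preorder {W : Type} [Fintype W] [LinearOrder W] (r : W → W → Prop)
    (refl : ∀ a, r a a) (trans : ∀ a b c, r a b → r b c → r a c) (v : W) :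
    ∃ s, (∀ w, r w s → r s w ∧ s ≤ w) ∧ r s v := by
  classical
  obtain ⟨w, hw, hmin⟩ := Finset.exists_min_image (Finset.univ.filter fun w => r w v)
    (fun w => (Finset.univ.filter fun x => r x w).card) ⟨v, by simp [refl]⟩
  simp only [Finset.mem_filter, Finset.mem_univ, true_and] at hw hmin
  have hback : ∀ x, r x w → r w x := by
    intro x hx
    have hsub : (Finset.univ.filter fun y => r y x) ⊆ Finset.univ.filter fun y => r y w := by
      intro y hy
      simp only [Finset.mem_filter, Finset.mem_univ, true_and] at hy ⊢
      exact trans _ _ _ hy hx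
    have heq := Finset.eq_of_subset_of_card_le hsub (hmin x (trans _ _ _ hx hw))
    have : w ∈ Finset.univ.filter fun y => r y x := by rw [heq]; simp [refl]
    simpa using this
  obtain ⟨s, hs, hsmin⟩ := Finset.exists_min_image (Finset.univ.filter fun x => r x w) id
    ⟨w, by simp [refl]⟩
  simp only [Finset.mem_filter, Finset.mem_univ, true_and, id] at hs hsmin
  refine ⟨s, fun x hx => ?_, trans _ _ _ hs hw⟩
  have hxw := trans _ _ _ hx hs
  exact ⟨trans _ _ _ hs (hback x hxw), hsmin x hxw⟩

variable [Fintype V]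

theorem exists_isSrc (F : Finset (V × V)) (v : V) : ∃ s, IsSrc F s ∧ Reach F s v :=
  exists_minimal_of_preorder (Reach F) (fun _ => .refl) (fun _ _ _ => Reach.trans) v

theorem exists_isTgt (F : Finset (V × V)) (v : V) : ∃ t, IsTgt F t ∧ Reach F v t :=
  exists_minimal_of_preorder (fun a b => Reach F b a) (fun _ => .refl)
    (fun _ _ _ h h' => Reach.trans h' h) v

open Classical in
noncomputable def srcs (F : Finset (V × V)) : Finset V := Finset.univ.filter (IsSrc F)

open Classical in
noncomputable def tgts (F : Finset (V × V)) : Finset V := Finset.univ.filter (IsTgt F)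

theorem mem_srcs {F : Finset (V × V)} {v : V} : v ∈ srcs F ↔ IsSrc F v := by simp [srcs]

theorem mem_tgts {F : Finset (V × V)} {v : V} : v ∈ tgts F ↔ IsTgt F v := by simp [tgts]

omit [LinearOrder V] [Fintype V] in
theorem isSCC_of_mutual (F : Finset (V × V)) (s : V) :
    IsSCC F {w | Reach F s w ∧ Reach F w s} := by
  refine ⟨fun u hu v hv => ⟨hu.2.trans hv.1, hv.2.trans hu.1⟩, fun T hT hle w hw => ?_⟩
  exact hT s (hle ⟨.refl, .refl⟩) w hw

/-- Sending a representative to its class is injective. The two hypotheses supply the leaving edge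
that `IsSourceSCC` demands: a class that no edge enters or leaves would be the whole digraph. -/
theorem card_srcs_le {F : Finset (V × V)} (hF : WeaklyConnected F) (hn : ¬ StronglyConnected F) :
    (srcs F).card ≤ numSource F := by
  rw [← Set.ncard_coe_finset, numSource,
    ← Set.InjOn.ncard_image (f := fun s => {w | Reach F s w ∧ Reach F w s})]
  · refine Set.ncard_le_ncard ?_ (Set.toFinite _)
    rintro _ ⟨s, hs, rfl⟩
    have hs' : IsSrc F s := mem_srcs.1 hs
    refine ⟨isSCC_of_mutual F s, ?_, ?_⟩
    · by_contra hout
      apply hn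
      have := hF.forall_of_closed (p := fun w => Reach F s w ∧ Reach F w s) ⟨.refl, .refl⟩ (by
        intro x y hxy
        constructor
        · intro hx
          by_contra hy
          exact hout ⟨(x, y), hxy, hx, hy⟩
        · rintro ⟨_, hy⟩
          have hxs : Reach F x s := (Reach.of_edge hxy).trans hy
          exact ⟨(hs' x hxs).1, hxs⟩)
      exact fun u v => (this u).2.trans (this v).1
    · rintro ⟨e, he, h1, h2⟩
      have h3 : Reach F e.1 s := (Reach.of_edge he).trans h2.2
      exact h1 ⟨(hs' _ h3).1, h3⟩
  · intro s hs s' hs' heq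
    have h1 : s ∈ {w | Reach F s w ∧ Reach F w s} := ⟨.refl, .refl⟩
    simp only at heq
    rw [heq] at h1
    exact (mem_srcs.1 hs).eq (mem_srcs.1 hs') h1.2

theorem card_tgts_le {F : Finset (V × V)} (hF : WeaklyConnected F) (hn : ¬ StronglyConnected F) :
    (tgts F).card ≤ numTarget F := by
  rw [← Set.ncard_coe_finset, numTarget,
    ← Set.InjOn.ncard_image (f := fun s => {w | Reach F s w ∧ Reach F w s})]
  · refine Set.ncard_le_ncard ?_ (Set.toFinite _)
    rintro _ ⟨s, hs, rfl⟩
    have hs' : IsTgt F s := mem_tgts.1 hs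
    refine ⟨isSCC_of_mutual F s, ?_, ?_⟩
    · rintro ⟨e, he, h1, h2⟩
      have h3 : Reach F s e.2 := h1.1.trans (Reach.of_edge he)
      exact h2 ⟨h3, (hs' _ h3).1⟩
    · by_contra hin
      apply hn
      have := hF.forall_of_closed (p := fun w => Reach F s w ∧ Reach F w s) ⟨.refl, .refl⟩ (by
        intro x y hxy
        constructor
        · rintro ⟨hx, _⟩
          have hsy : Reach F s y := hx.trans (Reach.of_edge hxy)
          exact ⟨hsy, (hs' y hsy).1⟩
        · intro hy
          by_contra hx
          exact hin ⟨(x, y), hxy, hx, hy⟩)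
      exact fun u v => (this u).2.trans (this v).1
  · intro s hs s' hs' heq
    have h1 : s ∈ {w | Reach F s w ∧ Reach F w s} := ⟨.refl, .refl⟩
    simp only at heq
    rw [heq] at h1
    exact (mem_tgts.1 hs).eq (mem_tgts.1 hs') h1.2

/-- The set `A` of edges may be added to the digraph `F` in one round, if the source representatives
propose to targets as told by `c`. -/
structure Augmentation (F A : Finset (V × V)) (c : V → Option V) : Prop where
  choice_some : ∀ s t, c s = some t →
    IsSrc F s ∧ IsTgt F t ∧ Reach F s t ∧ ∃ s', s' ≠ s ∧ IsSrc F s' ∧ Reach F s' t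
  choice_none : ∀ s, IsSrc F s → c s = none → ∀ t, IsTgt F t → Reach F s t →
    ∀ s', IsSrc F s' → Reach F s' t → s' = s
  sub : ∀ t s, (t, s) ∈ A → (c s = none ∧ IsSrc F s ∧ IsTgt F t ∧ Reach F s t) ∨ c s = some t
  edge_of_none : ∀ s, IsSrc F s → c s = none → ∀ t, IsTgt F t → Reach F s t → (t, s) ∈ A
  -- The alternatives are the two branches of Phase 4; in the second one all proposers of `t` get
  -- their edges.
  edge_of_some : ∀ s t, c s = some t →
    (∃ s', c s' = some t ∧ (t, s') ∈ A ∧ ∃ t', t' ≠ t ∧ IsTgt F t' ∧ Reach F s' t') ∨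
    ∀ s', c s' = some t → (t, s') ∈ A ∧ ∀ t', IsTgt F t' → Reach F s' t' → t' = t

/-- A source representative that all its targets know as the only one is the only one at all. -/
theorem Augmentation.stronglyConnected_of_none {F A : Finset (V × V)} {c : V → Option V}
    (h : Augmentation F A c) (hF : WeaklyConnected F) {s : V} (hs : IsSrc F s) (hc : c s = none) :
    StronglyConnected (F ∪ A) ∧ A.card ≤ Fintype.card V := by
  -- The set reached from `s` is also closed backwards along an edge from `x` to `y`: a source above
  -- `x` reaches a target that `s` reaches through `y`, and `s` is the only source there.
  have hall : ∀ v, Reach F s v := by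
    refine hF.forall_of_closed (p := fun v => Reach F s v) .refl fun x y hxy => ⟨fun hx => ?_, fun hy => ?_⟩
    · exact hx.trans (.of_edge hxy)
    · obtain ⟨t, ht, hyt⟩ := exists_isTgt F y
      obtain ⟨s', hs', hsx⟩ := exists_isSrc F x
      have := h.choice_none s hs hc t ht (hy.trans hyt) s' hs'
        (hsx.trans ((Reach.of_edge hxy).trans hyt))
      rwa [← this]
  constructor
  · intro u v
    obtain ⟨t, ht, hut⟩ := exists_isTgt F u
    have h1 : Reach (F ∪ A) u t := hut.mono Finset.subset_union_left
    have h2 : Reach (F ∪ A) t s :=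
      .of_edge (Finset.mem_union_right _ (h.edge_of_none s hs hc t ht (hall t)))
    exact h1.trans (h2.trans ((hall v).mono Finset.subset_union_left))
  · have hsub : A ⊆ Finset.univ.image fun t => (t, s) := by
      rintro ⟨t, s'⟩ he
      have hs' : IsSrc F s' := by
        rcases h.sub t s' he with h1 | h1
        · exact h1.2.1
        · exact (h.choice_some s' t h1).1
      simp [hs.eq hs' (hall s')]
    exact (Finset.card_le_card hsub).trans Finset.card_image_le

/-- The added edges have distinct heads; let `D` be the set of these heads among the old sources
`S`. Choose for every new source an old one that reaches it, and let `I` be the set of the chosen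
ones. An element of `D ∩ I` can be matched with an old source outside `I`, and `D \ I` lies outside
`I` anyway. So `D` has at most twice as many elements as `S \ I`, whose size is the drop in the
number of sources. -/
theorem Augmentation.card_add_le {F A : Finset (V × V)} {c : V → Option V}
    (h : Augmentation F A c) (hc : ∀ s, IsSrc F s → c s ≠ none) :
    A.card + 2 * (srcs (F ∪ A)).card ≤ 2 * (srcs F).card := by
  classical
  have hsub : ∀ t s, (t, s) ∈ A → c s = some t := by
    intro t s he
    rcases h.sub t s he with h1 | h1
    · exact absurd h1.1 (hc s h1.2.1)
    · exact h1
  have hA : A.card = (A.image Prod.snd).card := by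
    refine (Finset.card_image_of_injOn ?_).symm
    rintro ⟨t, s⟩ h1 ⟨t', s'⟩ h2 (rfl : s = s')
    have k1 := hsub t s h1
    have k2 := hsub t' s h2
    rw [k1] at k2
    simp only [Option.some.injEq] at k2
    rw [k2]
  set D := A.image Prod.snd with hD
  have hDs : D ⊆ srcs F := by
    intro s hs
    obtain ⟨⟨t, s'⟩, he, rfl⟩ := Finset.mem_image.1 hs
    exact mem_srcs.2 (h.choice_some _ _ (hsub t s' he)).1
  choose f hf1 hf2 using exists_isSrc F
  have hmono : F ⊆ F ∪ A := Finset.subset_union_left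
  have hsep : ∀ y ∈ srcs (F ∪ A), ∀ y' ∈ srcs (F ∪ A), ∀ x, Reach (F ∪ A) x y →
      Reach (F ∪ A) x y' → y = y' := by
    intro y hy y' hy' x hx hx'
    rw [mem_srcs] at hy hy'
    exact hy.eq hy' ((hy x hx).1.trans hx')
  have hfy : ∀ y, Reach (F ∪ A) (f y) y := fun y => (hf2 y).mono hmono
  have hfinj : Set.InjOn f (srcs (F ∪ A)) := by
    intro y hy y' hy' heq
    exact hsep y hy y' hy' (f y) (hfy y) (by rw [heq]; exact hfy y')
  set I := (srcs (F ∪ A)).image f with hI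
  have hIcard : I.card = (srcs (F ∪ A)).card := Finset.card_image_of_injOn hfinj
  have hIs : I ⊆ srcs F := by
    intro x hx
    obtain ⟨y, _, rfl⟩ := Finset.mem_image.1 hx
    exact mem_srcs.2 (hf1 y)
  -- The source `f y` proposed to a target that is reached from a second source `x`; through the new
  -- edge `x` reaches `f y`, and so `y`.
  have hg : ∀ y, f y ∈ D → ∃ x, x ≠ f y ∧ IsSrc F x ∧ Reach (F ∪ A) x y := by
    intro y hy
    obtain ⟨⟨t, s'⟩, he, hs'⟩ := Finset.mem_image.1 hy
    simp only at hs'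
    subst hs'
    obtain ⟨_, _, _, x, hx, hxs, hxt⟩ := h.choice_some _ _ (hsub _ _ he)
    refine ⟨x, hx, hxs, (hxt.mono hmono).trans (Reach.trans (.of_edge ?_) (hfy y))⟩
    exact Finset.mem_union_right _ he
  choose! g hg1 hg2 hg3 using hg
  have h1 : (D ∩ I).card ≤ (srcs F \ I).card := by
    have e : D ∩ I = ((srcs (F ∪ A)).filter fun y => f y ∈ D).image f := by
      ext x
      simp only [hI, Finset.mem_inter, Finset.mem_image, Finset.mem_filter]
      constructor
      · rintro ⟨hx, y, hy, rfl⟩; exact ⟨y, ⟨hy, hx⟩, rfl⟩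
      · rintro ⟨y, ⟨hy, hx⟩, rfl⟩; exact ⟨hx, y, hy, rfl⟩
    rw [e]
    refine Finset.card_image_le.trans (Finset.card_le_card_of_injOn g ?_ ?_)
    -- If the partner `g y` were chosen for some `y'`, it would reach both `y` and `y'`; then `y' =
    -- y` and `g y = f y`.
    · intro y hy
      simp only [Finset.coe_filter, Set.mem_ofPred_eq] at hy
      rw [Finset.mem_coe, Finset.mem_sdiff]
      refine ⟨mem_srcs.2 (hg2 y hy.2), fun hgI => ?_⟩
      obtain ⟨y', hy', heq⟩ := Finset.mem_image.1 hgI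
      have := hsep y hy.1 y' hy' (g y) (hg3 y hy.2) (by rw [← heq]; exact hfy y')
      subst this
      exact hg1 y hy.2 heq.symm
    · intro y hy y' hy' heq
      simp only [Finset.coe_filter, Set.mem_ofPred_eq] at hy hy'
      exact hsep y hy.1 y' hy'.1 (g y) (hg3 y hy.2) (by rw [heq]; exact hg3 y' hy'.2)
  have h2 : (D \ I).card ≤ (srcs F \ I).card := Finset.card_le_card (Finset.sdiff_subset_sdiff hDs le_rfl)
  have h3 := Finset.card_sdiff_add_card_inter D I
  have h4 := Finset.card_sdiff_add_card_eq_card hIs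
  omega

/-- Choosing for every new target an old one that it reaches is injective, but cannot hit both `t`
and `t'`, because the new edge lets `t` reach `t'`. -/
theorem Augmentation.card_tgts_lt {F A : Finset (V × V)} {s t t' : V} (he : (t, s) ∈ A)
    (ht : IsTgt F t) (hne : t' ≠ t) (ht' : IsTgt F t') (hst' : Reach F s t') :
    (tgts (F ∪ A)).card < (tgts F).card := by
  classical
  choose f hf1 hf2 using exists_isTgt F
  have hmono : F ⊆ F ∪ A := Finset.subset_union_left
  have hfy : ∀ y, Reach (F ∪ A) y (f y) := fun y => (hf2 y).mono hmono
  have hsep : ∀ y ∈ tgts (F ∪ A), ∀ y' ∈ tgts (F ∪ A), ∀ x, Reach (F ∪ A) y x →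
      Reach (F ∪ A) y' x → y = y' := by
    intro y hy y' hy' x hx hx'
    rw [mem_tgts] at hy hy'
    exact hy.eq hy' (hx.trans (hy' x hx').1)
  have hfinj : Set.InjOn f (tgts (F ∪ A)) := by
    intro y hy y' hy' heq
    exact hsep y hy y' hy' (f y) (hfy y) (by rw [heq]; exact hfy y')
  rw [← Finset.card_image_of_injOn hfinj]
  refine Finset.card_lt_card ⟨?_, fun hsub => ?_⟩
  · intro x hx
    obtain ⟨y, _, rfl⟩ := Finset.mem_image.1 hx
    exact mem_tgts.2 (hf1 y)
  · obtain ⟨y, hy, hyt⟩ := Finset.mem_image.1 (hsub (mem_tgts.2 ht))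
    obtain ⟨y', hy', hyt'⟩ := Finset.mem_image.1 (hsub (mem_tgts.2 ht'))
    have h1 : Reach (F ∪ A) y t' := by
      refine (hyt ▸ hfy y).trans (Reach.trans (.of_edge ?_) (hst'.mono hmono))
      exact Finset.mem_union_right _ he
    have := hsep y hy y' hy' t' h1 (hyt' ▸ hfy y')
    subst this
    exact hne (hyt'.symm.trans hyt)

/-- A round makes the digraph strongly connected, or it lowers the numbers of source components and of
target components. -/
theorem Augmentation.progress {F A : Finset (V × V)} {c : V → Option V} (h : Augmentation F A c)
    (hF : WeaklyConnected F) :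
    (StronglyConnected (F ∪ A) ∧ A.card ≤ Fintype.card V) ∨
    ((srcs (F ∪ A)).card < (srcs F).card ∧ (tgts (F ∪ A)).card < (tgts F).card ∧
      A.card + 2 * (srcs (F ∪ A)).card ≤ 2 * (srcs F).card) := by
  by_cases hc : ∀ s, IsSrc F s → c s ≠ none
  · by_cases hex : ∃ s t, c s = some t ∧ (t, s) ∈ A ∧ ∃ t', t' ≠ t ∧ IsTgt F t' ∧ Reach F s t'
    · right
      obtain ⟨s, t, hct, he, t', hne, ht', hst'⟩ := hex
      have h1 := h.card_add_le hc
      have h2 : 0 < A.card := Finset.card_pos.2 ⟨_, he⟩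
      exact ⟨by omega, Augmentation.card_tgts_lt he (h.choice_some s t hct).2.1 hne ht' hst', h1⟩
    · left
      have huniq : ∀ s t, c s = some t → (t, s) ∈ A ∧ ∀ t', IsTgt F t' → Reach F s t' → t' = t := by
        intro s t hst
        rcases h.edge_of_some s t hst with ⟨s', h1, h2, h3⟩ | h1
        · exact absurd ⟨s', t, h1, h2, h3⟩ hex
        · exact h1 s hst
      constructor
      · intro u v
        obtain ⟨t, ht, hut⟩ := exists_isTgt F u
        -- For an edge from `x` to `y` with `x` above `t`, a source above `x` reaches both `t` and
        -- some target below `y`; it has only one target, so `y` is above `t` too.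
        have hall : ∀ w, Reach F w t := by
          refine hF.forall_of_closed (p := fun w => Reach F w t) hut fun x y hxy =>
            ⟨fun hx => ?_, fun hy => (Reach.of_edge hxy).trans hy⟩
          obtain ⟨s, hs, hsx⟩ := exists_isSrc F x
          obtain ⟨t', ht', hyt'⟩ := exists_isTgt F y
          obtain ⟨t'', hst''⟩ := Option.ne_none_iff_exists'.1 (hc s hs)
          have h1 := (huniq s t'' hst'').2 t ht (hsx.trans hx)
          have h2 := (huniq s t'' hst'').2 t' ht' (hsx.trans ((Reach.of_edge hxy).trans hyt'))
          rw [h1, ← h2]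
          exact hyt'
        obtain ⟨s, hs, hsv⟩ := exists_isSrc F v
        obtain ⟨t', hst'⟩ := Option.ne_none_iff_exists'.1 (hc s hs)
        have h1 := (huniq s t' hst').2 t ht (hall s)
        subst h1
        exact (hut.mono Finset.subset_union_left).trans
          (Reach.trans (.of_edge (Finset.mem_union_right _ (huniq s t hst').1))
            (hsv.mono Finset.subset_union_left))
      · have hinj : Set.InjOn Prod.snd (A : Set (V × V)) := by
          rintro ⟨t, s⟩ h1 ⟨t', s'⟩ h2 (rfl : s = s')
          have key : ∀ t, (t, s) ∈ A → c s = some t := by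
            intro t he
            rcases h.sub t s he with h1 | h1
            · exact absurd h1.1 (hc s h1.2.1)
            · exact h1
          have := (key t h1).symm.trans (key t' h2)
          simp only [Option.some.injEq] at this
          rw [this]
        rw [← Finset.card_image_of_injOn hinj]
        exact Finset.card_le_univ _
  · left
    push Not at hc
    obtain ⟨s, hs, hcs⟩ := hc
    exact h.stronglyConnected_of_none hF hs hcs

omit [LinearOrder V] in
/-- In a weakly connected digraph that is not strongly connected every node lies on an edge. -/
theorem WeaklyConnected.card_le {F : Finset (V × V)} (hF : WeaklyConnected F)
    (hn : ¬ StronglyConnected F) : Fintype.card V ≤ 2 * F.card := by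
  classical
  have hsub : (Finset.univ : Finset V) ⊆ F.image Prod.fst ∪ F.image Prod.snd := by
    intro v _
    obtain ⟨w, hw⟩ : ∃ w, w ≠ v := by
      by_contra hc
      push Not at hc
      exact hn fun a b => by rw [hc a, hc b]; exact .refl
    rcases Relation.ReflTransGen.cases_head (hF v w) with h | ⟨x, h | h, -⟩
    · exact absurd h.symm hw
    · exact Finset.mem_union_left _ (Finset.mem_image.2 ⟨_, h, rfl⟩)
    · exact Finset.mem_union_right _ (Finset.mem_image.2 ⟨_, h, rfl⟩)
  have h1 := (Finset.card_le_card hsub).trans (Finset.card_union_le _ _)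
  have h2 : (F.image Prod.fst).card ≤ F.card := Finset.card_image_le
  have h3 : (F.image Prod.snd).card ≤ F.card := Finset.card_image_le
  rw [Finset.card_univ] at h1
  omega

omit [LinearOrder V] [Fintype V] in
-- This rules out premature exits: an agent sees no edge enter or leave its component only when the
-- whole digraph is strongly connected.
theorem WeaklyConnected.stronglyConnected_of_mutual {F : Finset (V × V)} (hF : WeaklyConnected F)
    {u : V} (h : ∀ w, Reach F w u ↔ Reach F u w) : StronglyConnected F := by
  have hall := hF.forall_of_closed (p := fun w => Reach F u w) .refl fun x y hxy =>
    ⟨fun hx => hx.trans (.of_edge hxy), fun hy =>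
      (h x).1 ((Reach.of_edge hxy).trans ((h y).2 hy))⟩
  exact fun a b => ((h a).2 (hall a)).trans (hall b)

end Progress

/-! ### The propagation of the edges -/

section Propagation

variable {V : Type} [Fintype V] [DecidableEq V]

theorem mem_outNbrs {F : Finset (V × V)} {u v : V} : v ∈ outNbrs F u ↔ (u, v) ∈ F := by
  simp [outNbrs]

theorem mem_inNbrs {F : Finset (V × V)} {u v : V} : v ∈ inNbrs F u ↔ (v, u) ∈ F := by
  simp [inNbrs]

/-- The nodes from which there is a path of fewer than `k` edges to `u`. -/
def ball (F : Finset (V × V)) : ℕ → V → Finset V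
  | 0, _ => ∅
  | k + 1, u => insert u ((inNbrs F u).biUnion (ball F k))

theorem mem_ball_succ {F : Finset (V × V)} {k : ℕ} {u w : V} :
    w ∈ ball F (k + 1) u ↔ w = u ∨ ∃ v, (v, u) ∈ F ∧ w ∈ ball F k v := by
  simp [ball, mem_inNbrs]

theorem ball_subset_succ (F : Finset (V × V)) (k : ℕ) (u : V) : ball F k u ⊆ ball F (k + 1) u := by
  induction k generalizing u with
  | zero => simp [ball]
  | succ k ih =>
    intro w hw
    rw [mem_ball_succ] at hw ⊢
    rcases hw with hw | ⟨v, hv, hw⟩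
    · exact .inl hw
    · exact .inr ⟨v, hv, ih v hw⟩

/-- The definition splits off the last edge of a path, as the messages do. Splitting off the first
edge keeps the centre fixed, which makes stability at a single node persist. -/
theorem mem_ball_succ' {F : Finset (V × V)} {k : ℕ} {u w : V} :
    w ∈ ball F (k + 1) u ↔ w = u ∨ ∃ x, (w, x) ∈ F ∧ x ∈ ball F k u := by
  induction k generalizing u w with
  | zero => simp [ball]
  | succ k ih =>
    rw [mem_ball_succ]
    simp only [ih (u := _) (w := w)]
    constructor
    · rintro (h | ⟨v, hv, rfl | ⟨x, hx, hxv⟩⟩)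
      · exact .inl h
      · exact .inr ⟨u, hv, mem_ball_succ.2 (.inl rfl)⟩
      · exact .inr ⟨x, hx, mem_ball_succ.2 (.inr ⟨v, hv, hxv⟩)⟩
    · rintro (h | ⟨x, hx, hxu⟩)
      · exact .inl h
      · rcases mem_ball_succ.1 hxu with rfl | ⟨v, hv, hxv⟩
        · exact .inr ⟨w, hx, .inl rfl⟩
        · exact .inr ⟨v, hv, .inr ⟨x, hx, hxv⟩⟩

theorem ball_stable {F : Finset (V × V)} {k : ℕ} {u : V} (h : ball F (k + 1) u = ball F k u) :
    ball F (k + 2) u = ball F (k + 1) u := by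
  ext w
  rw [mem_ball_succ' (k := k + 1), h, ← mem_ball_succ', h]

/-- By `ball_stable` a ball that still grows has gained at least one node in every earlier step. -/
theorem le_card_of_ball_ne {F : Finset (V × V)} {k : ℕ} {u : V}
    (h : ball F (k + 1) u ≠ ball F k u) : k + 1 ≤ (ball F (k + 1) u).card := by
  induction k with
  | zero => exact Finset.card_pos.2 ⟨u, mem_ball_succ.2 (.inl rfl)⟩
  | succ k ih =>
    have h1 := ih fun h' => h (ball_stable h')
    have h2 := Finset.card_lt_card ((ball_subset_succ F (k + 1) u).ssubset_of_ne h.symm)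
    omega

theorem reach_of_mem_ball {F : Finset (V × V)} {k : ℕ} {u w : V} (h : w ∈ ball F k u) :
    Reach F w u := by
  induction k generalizing u with
  | zero => simp [ball] at h
  | succ k ih =>
    rcases mem_ball_succ.1 h with rfl | ⟨v, hv, hw⟩
    · exact .refl
    · exact .tail (ih hw) hv

theorem mem_ball_of_reach {F : Finset (V × V)} {k : ℕ} {u w : V}
    (h : ball F (k + 2) u = ball F (k + 1) u) (hw : Reach F w u) : w ∈ ball F (k + 1) u := by
  induction hw using Relation.ReflTransGen.head_induction_on with
  | refl => exact mem_ball_succ.2 (.inl rfl)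
  | @head a c hac _ ih =>
    rw [← h, mem_ball_succ']
    exact .inr ⟨c, hac, ih⟩

/-- The edges that start in `ball F k u`. -/
def ballEdges (F : Finset (V × V)) (k : ℕ) (u : V) : Finset (V × V) :=
  F.filter fun e => e.1 ∈ ball F k u

theorem mem_ballEdges {F : Finset (V × V)} {k : ℕ} {u : V} {e : V × V} :
    e ∈ ballEdges F k u ↔ e ∈ F ∧ e.1 ∈ ball F k u := by simp [ballEdges]

theorem ballEdges_subset_succ (F : Finset (V × V)) (k : ℕ) (u : V) :
    ballEdges F k u ⊆ ballEdges F (k + 1) u := fun _ he =>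
  mem_ballEdges.2 ⟨(mem_ballEdges.1 he).1, ball_subset_succ F k u (mem_ballEdges.1 he).2⟩

/-- Every node of the ball other than the centre has an edge towards it, so the edges determine the
ball. The indices start at 1: `ball F 0 u` is empty, and a centre without out-neighbours would be a
counterexample. -/
theorem ball_eq_of_ballEdges_eq {F : Finset (V × V)} {k : ℕ} {u : V}
    (h : ballEdges F (k + 2) u = ballEdges F (k + 1) u) :
    ball F (k + 2) u = ball F (k + 1) u := by
  refine (Finset.Subset.antisymm (ball_subset_succ F (k + 1) u) fun w hw => ?_).symm
  rcases mem_ball_succ'.1 hw with rfl | ⟨x, hx, _⟩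
  · exact mem_ball_succ.2 (.inl rfl)
  · have : (w, x) ∈ ballEdges F (k + 2) u := mem_ballEdges.2 ⟨hx, hw⟩
    rw [h] at this
    exact (mem_ballEdges.1 this).2

/-- The local stopping rule is sound: once a pass brings nothing new, nothing is missing. -/
theorem ballEdges_eq_knownEdges {F : Finset (V × V)} {k : ℕ} {u : V}
    (h : ballEdges F (k + 2) u = ballEdges F (k + 1) u) :
    ballEdges F (k + 2) u = knownEdges F u := by
  ext e
  rw [h, mem_ballEdges, mem_knownEdges]
  exact ⟨fun he => ⟨he.1, reach_of_mem_ball he.2⟩,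
    fun he => ⟨he.1, mem_ball_of_reach (ball_eq_of_ballEdges_eq h) he.2⟩⟩

theorem ballEdges_one (F : Finset (V × V)) (u : V) (e : V × V) :
    e ∈ ballEdges F 1 u ↔ ∃ v ∈ outNbrs F u, (u, v) = e := by
  obtain ⟨a, b⟩ := e
  rw [mem_ballEdges, mem_ball_succ (k := 0)]
  simp only [ball, mem_outNbrs, Prod.mk.injEq]
  constructor
  · rintro ⟨h, rfl | ⟨v, _, hv⟩⟩
    · exact ⟨b, h, rfl, rfl⟩
    · simp at hv
  · rintro ⟨v, h, rfl, rfl⟩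
    exact ⟨h, .inl rfl⟩

/-- What the in-neighbours know after a pass is what they sent in it and what `u` knew before. -/
theorem ballEdges_union_biUnion (F : Finset (V × V)) (k : ℕ) (u : V) :
    ballEdges F (k + 1) u ∪
      (inNbrs F u).biUnion (fun v => ballEdges F (k + 1) v \ ballEdges F k v) =
      ballEdges F (k + 2) u := by
  ext e
  simp only [Finset.mem_union, Finset.mem_biUnion, Finset.mem_sdiff, mem_inNbrs, mem_ballEdges]
  constructor
  · rintro (⟨h1, h2⟩ | ⟨v, hv, ⟨h1, h2⟩, _⟩)
    · exact ⟨h1, ball_subset_succ F _ u h2⟩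
    · exact ⟨h1, mem_ball_succ.2 (.inr ⟨v, hv, h2⟩)⟩
  · rintro ⟨h1, h2⟩
    rcases mem_ball_succ.1 h2 with h2 | ⟨v, hv, h2⟩
    · exact .inl ⟨h1, mem_ball_succ.2 (.inl h2)⟩
    · by_cases h3 : e.1 ∈ ball F k v
      · exact .inl ⟨h1, mem_ball_succ.2 (.inr ⟨v, hv, h3⟩)⟩
      · exact .inr ⟨v, hv, ⟨h1, h2⟩, fun h => h3 h.2⟩

end Propagation

/-! ### Results and costs of the remaining local programs. -/

section Programs

variable {V : Type} [DecidableEq V]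

theorem beginRound_spec (u : V) (out : Finset V) :
    ∃ x : Finset (V × V),
      (beginRound u out).val = ({ Agent.initial V with known := x, fresh := x, active := true }, ∅) ∧
      (∀ e, e ∈ x ↔ ∃ v ∈ out, (u, v) = e) ∧ (beginRound u out).steps ≤ out.card + 2 := by
  refine ⟨_, rfl, fun e => ?_, ?_⟩
  · rw [loop_insert (fun v => (u, v)) _ fun _ _ => rfl]
    simp
  · have := loop_steps_le_const (fun (x : Finset (V × V)) v => pure (insert (u, v) x)) 0 out.toList
      (fun _ _ _ => le_rfl) ∅
    rw [Finset.length_toList] at this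
    unfold beginRound
    simp only [steps_bind, steps_tick, steps_pure]
    omega

/-- The body of the inner loop of `propagate`. -/
def receive (r : Finset (V × V) × Finset (V × V)) (e : V × V) :
    Timed (Finset (V × V) × Finset (V × V)) :=
  if e ∈ r.1 then pure r else pure (insert e r.1, insert e r.2)

theorem loop_receive_val (r : Finset (V × V) × Finset (V × V)) (l : List (V × V)) :
    (loop receive r l).val = (r.1 ∪ l.toFinset, r.2 ∪ (l.toFinset \ r.1)) := by
  induction l generalizing r with
  | nil => simp
  | cons e l ih =>
    rw [loop_cons_val, ih]
    by_cases he : e ∈ r.1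
    · simp only [receive, he, if_true, val_pure, List.toFinset_cons, Finset.insert_sdiff_of_mem]
      rw [Finset.union_insert, Finset.insert_eq_of_mem (Finset.mem_union_left _ he)]
    · simp only [receive, he, if_false, val_pure, List.toFinset_cons]
      refine Prod.ext ?_ ?_ <;> ext x <;>
        simp only [Finset.mem_union, Finset.mem_insert, Finset.mem_sdiff]
      · tauto
      · by_cases hx : x = e
        · subst hx; simp [he]
        · simp [hx]

theorem loop_receive_steps (r : Finset (V × V) × Finset (V × V)) (l : List (V × V)) :
    (loop receive r l).steps ≤ l.length + 1 := by
  have := loop_steps_le_const (receive (V := V)) 0 l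
    (fun r e _ => by unfold receive; split_ifs <;> simp) r
  simpa using this

theorem loop_loop_receive_val (r : Finset (V × V) × Finset (V × V)) (msg : V → Finset (V × V))
    (l : List V) :
    (loop (fun r v => loop receive r (msg v).toList) r l).val =
      (r.1 ∪ l.toFinset.biUnion msg, r.2 ∪ (l.toFinset.biUnion msg \ r.1)) := by
  induction l generalizing r with
  | nil => simp
  | cons v l ih =>
    rw [loop_cons_val, ih, loop_receive_val]
    simp only [Finset.toList_toFinset, List.toFinset_cons, Finset.biUnion_insert]
    refine Prod.ext ?_ ?_ <;> ext x <;> simp only [Finset.mem_union, Finset.mem_sdiff] <;> tauto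

theorem propagate_spec (a : Agent V) (out inn : Finset V) (msg : V → Finset (V × V))
    (ha : a.active = true) :
    (propagate a out inn msg).val =
      ({ a with
          known := a.known ∪ inn.biUnion msg
          fresh := inn.biUnion msg \ a.known
          active := !decide (inn.biUnion msg \ a.known = ∅) }, ∅) ∧
    (propagate a out inn msg).steps ≤
      2 + out.card * (a.fresh.card + 1) + (∑ v ∈ inn, (msg v).card + 2 * inn.card) := by
  have e : propagate a out inn msg = (do
      tick 1
      tick (out.card * (a.fresh.card + 1))
      let r ← loop (fun r v => loop receive r (msg v).toList) (a.known, ∅) inn.toList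
      pure ({ a with known := r.1, fresh := r.2, active := !decide (r.2 = ∅) }, ∅)) := by
    unfold propagate
    rw [ha]
    rfl
  rw [e]
  constructor
  · simp only [val_bind, val_pure, loop_loop_receive_val, Finset.toList_toFinset,
      Finset.empty_union]
  · have h := loop_steps_le (fun r v => loop receive r (msg v).toList)
      (fun v => (msg v).card + 1) inn.toList
      (fun r v _ => by simpa using loop_receive_steps r (msg v).toList) (a.known, ∅)
    rw [Finset.length_toList, Finset.sum_map_toList, Finset.sum_add_distrib, Finset.sum_const,
      smul_eq_mul, mul_one] at h
    simp only [steps_bind, steps_tick, steps_pure]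
    omega

theorem phase3_spec [Fintype V] (u : V) (a : Agent V) (inbox : List V) (msg : V → Finset V)
    (hrole : a.role = .source) (hc : a.choice = none) (hnd : inbox.Nodup) :
    ∃ (P : Finset V) (c : Option V) (A : Finset (V × V)),
      (phase3 u a inbox msg).val = ({ a with proposers := P, choice := c }, A) ∧
      (∀ t, t ∈ P ↔ t ∈ inbox) ∧
      ((∃ t ∈ inbox, 1 < (msg t).card ∧ c = some t ∧ A = ∅) ∨
        ((∀ t ∈ inbox, (msg t).card ≤ 1) ∧ c = none ∧ ∀ e, e ∈ A ↔ ∃ t ∈ inbox, (t, u) = e)) ∧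
      (phase3 u a inbox msg).steps ≤
        Fintype.card V * Fintype.card V + 4 * Fintype.card V + 4 := by
  set Pl := loop (fun (P : Finset V) t => do
        tick (1 + (msg t).card)
        pure (insert t P)) ∅ inbox with hPl
  set cl := search (fun t => decide (1 < (msg t).card)) inbox with hcl
  set Fl := loop (fun (F : Finset (V × V)) t => pure (insert (t, u) F)) ∅ inbox with hFl
  have hP : ∀ t, t ∈ Pl.val ↔ t ∈ inbox := by
    intro t
    rw [hPl, loop_insert id _ fun _ _ => rfl]
    simp
  have e : phase3 u a inbox msg = (do
      tick 1
      let P ← Pl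
      let c ← cl
      match c with
      | some t => do
        tick (1 + P.card)
        pure ({ a with proposers := P, choice := some t }, ∅)
      | none => do
        let F ← Fl
        pure ({ a with proposers := P }, F)) := by
    unfold phase3
    rw [hrole]
    rfl
  have hlen : inbox.length ≤ Fintype.card V := hnd.length_le_card
  have e1 : Pl.steps ≤ inbox.length * (Fintype.card V + 2) + 1 := by
    have := loop_steps_le_const (fun (P : Finset V) t => do
        tick (1 + (msg t).card)
        pure (insert t P)) (Fintype.card V + 1) inbox (fun P t _ => by
          have : (msg t).card ≤ Fintype.card V := Finset.card_le_univ _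
          simp only [steps_bind, steps_tick, steps_pure]
          omega) ∅
    rw [← hPl] at this
    rw [mul_comm]
    exact this
  have e2 : cl.steps ≤ inbox.length + 1 := search_steps_le _ _
  have e3 : Fl.steps ≤ inbox.length + 1 := by
    have := loop_steps_le_const (fun (F : Finset (V × V)) t => pure (insert (t, u) F)) 0 inbox
      (fun _ _ _ => le_rfl) ∅
    rwa [zero_add, one_mul] at this
  have e4 : inbox.length * (Fintype.card V + 2) ≤ Fintype.card V * Fintype.card V +
      2 * Fintype.card V := by
    calc _ ≤ Fintype.card V * (Fintype.card V + 2) := Nat.mul_le_mul_right _ hlen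
      _ = _ := by ring
  have e5 : Pl.val.card ≤ Fintype.card V := Finset.card_le_univ _
  rw [e]
  cases hcv : cl.val with
  | some t =>
    obtain ⟨h1, h2⟩ := search_eq_some hcv
    refine ⟨Pl.val, some t, ∅, by simp only [val_bind, hcv, val_pure], hP,
      .inl ⟨t, h1, by simpa using h2, rfl, rfl⟩, ?_⟩
    simp only [steps_bind, steps_tick, hcv, steps_pure]
    omega
  | none =>
    have h1 := search_eq_none hcv
    refine ⟨Pl.val, none, Fl.val, by simp only [val_bind, hcv, val_pure, hc], hP,
      .inr ⟨fun t ht => by simpa using h1 t ht, rfl, fun e => ?_⟩, ?_⟩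
    · rw [hFl, loop_insert (fun t => (t, u)) _ fun _ _ => rfl]
      simp
    · simp only [steps_bind, steps_tick, hcv, steps_pure]
      omega

theorem phase4_spec [Fintype V] (u : V) (a : Agent V) (inbox : List V) (msg : V → Finset V)
    (hrole : a.role = .target) (hnd : inbox.Nodup) :
    ∃ A : Finset (V × V), (phase4 u a inbox msg).val = (a, A) ∧
      ((∃ s ∈ inbox, 1 < (msg s).card ∧ A = {(u, s)}) ∨
        ((∀ s ∈ inbox, (msg s).card ≤ 1) ∧ ∀ e, e ∈ A ↔ ∃ s ∈ inbox, (u, s) = e)) ∧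
      (phase4 u a inbox msg).steps ≤
        Fintype.card V * Fintype.card V + 4 * Fintype.card V + 4 := by
  set Pl := loop (fun (_ : Unit) s => tick (1 + (msg s).card)) () inbox with hPl
  set cl := search (fun t => decide (1 < (msg t).card)) inbox with hcl
  set Fl := loop (fun (F : Finset (V × V)) s => pure (insert (u, s) F)) ∅ inbox with hFl
  have e : phase4 u a inbox msg = (do
      tick 1
      let _ ← Pl
      let c ← cl
      match c with
      | some s => pure (a, {(u, s)})
      | none => do
        let F ← Fl
        pure (a, F)) := by
    unfold phase4
    rw [hrole]
    rfl
  have hlen : inbox.length ≤ Fintype.card V := hnd.length_le_card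
  have e1 : Pl.steps ≤ inbox.length * (Fintype.card V + 2) + 1 := by
    have := loop_steps_le_const (fun (_ : Unit) s => tick (1 + (msg s).card)) (Fintype.card V + 1)
      inbox (fun P t _ => by
          have : (msg t).card ≤ Fintype.card V := Finset.card_le_univ _
          simp only [steps_tick]
          omega) ()
    rw [← hPl] at this
    rw [mul_comm]
    exact this
  have e2 : cl.steps ≤ inbox.length + 1 := search_steps_le _ _
  have e3 : Fl.steps ≤ inbox.length + 1 := by
    have := loop_steps_le_const (fun (F : Finset (V × V)) s => pure (insert (u, s) F)) 0 inbox
      (fun _ _ _ => le_rfl) ∅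
    rwa [zero_add, one_mul] at this
  have e4 : inbox.length * (Fintype.card V + 2) ≤ Fintype.card V * Fintype.card V +
      2 * Fintype.card V := by
    calc _ ≤ Fintype.card V * (Fintype.card V + 2) := Nat.mul_le_mul_right _ hlen
      _ = _ := by ring
  rw [e]
  cases hcv : cl.val with
  | some s =>
    obtain ⟨h1, h2⟩ := search_eq_some hcv
    refine ⟨{(u, s)}, by simp only [val_bind, hcv, val_pure],
      .inl ⟨s, h1, by simpa using h2, rfl⟩, ?_⟩
    simp only [steps_bind, steps_tick, hcv, steps_pure]
    omega
  | none =>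
    have h1 := search_eq_none hcv
    refine ⟨Fl.val, by simp only [val_bind, hcv, val_pure],
      .inr ⟨fun t ht => by simpa using h1 t ht, fun e => ?_⟩, ?_⟩
    · rw [hFl, loop_insert (fun s => (u, s)) _ fun _ _ => rfl]
      simp
    · simp only [steps_bind, steps_tick, hcv, steps_pure]
      omega

end Programs

/-! ### One round of the network -/

section Round

variable {V : Type} [Fintype V]

theorem Net.exec_eq [DecidableEq V] (N : Net V) (next : Stage)
    (prog : V → Timed (Agent V × Finset (V × V))) (h : ∀ u, (N.agent u).role ≠ .exited) :
    N.exec next prog =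
      { stage := next
        added := N.added ∪ Finset.univ.biUnion fun u => (prog u).val.2
        agent := fun u => (prog u).val.1
        time := fun u => N.time u + (prog u).steps } := by
  unfold Net.exec
  simp [h]

/-- The number of edges of `F` that start in the ball and end in `u` or one of its in-neighbours; it
measures what `u` has sent and received. -/
def traffic [DecidableEq V] (F : Finset (V × V)) (k : ℕ) (u : V) : ℕ :=
  Fintype.card V * (ballEdges F k u).card + ∑ v ∈ inNbrs F u, (ballEdges F k v).card

theorem traffic_le [DecidableEq V] (F : Finset (V × V)) (k : ℕ) (u : V) :
    traffic F k u ≤ 2 * (Fintype.card V * F.card) := by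
  have h1 : ∀ v, (ballEdges F k v).card ≤ F.card := fun v => Finset.card_filter_le _ _
  have h2 : ∑ v ∈ inNbrs F u, (ballEdges F k v).card ≤ (inNbrs F u).card * F.card := by
    rw [← smul_eq_mul, ← Finset.sum_const]
    exact Finset.sum_le_sum fun v _ => h1 v
  have h3 : (inNbrs F u).card ≤ Fintype.card V := Finset.card_le_univ _
  have h4 := Nat.mul_le_mul_left (Fintype.card V) (h1 u)
  have h5 := Nat.mul_le_mul_right F.card h3
  unfold traffic
  omega

/-- The increment bounds the edges sent and received in one pass, so the costs of all passes
telescope to the bound of `traffic_le`. -/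
theorem traffic_succ [DecidableEq V] (F : Finset (V × V)) (k : ℕ) (u : V) :
    traffic F (k + 1) u = traffic F k u +
      (Fintype.card V * (ballEdges F (k + 1) u \ ballEdges F k u).card +
        ∑ v ∈ inNbrs F u, (ballEdges F (k + 1) v \ ballEdges F k v).card) := by
  have h : ∀ v, (ballEdges F (k + 1) v).card =
      (ballEdges F k v).card + (ballEdges F (k + 1) v \ ballEdges F k v).card := fun v => by
    have := Finset.card_sdiff_add_card_eq_card (ballEdges_subset_succ F k v)
    omega
  unfold traffic
  rw [h u, Finset.sum_congr rfl fun v _ => h v, Finset.sum_add_distrib]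
  ring

variable [LinearOrder V] {E : Finset (V × V)} {ord : DeliveryOrder V}

/-- The state of the network after `k` passes of the propagation, if the network had the edges `F` and
the agents had spent the times `T` at the start of the round. -/
structure PropagationState (F added : Finset (V × V)) (T : V → ℕ) (k : ℕ) (N : Net V) : Prop where
  stage : N.stage = .propagation
  added_eq : N.added = added
  agent : ∀ u, N.agent u = { Agent.initial V with
    known := ballEdges F (k + 1) u
    fresh := ballEdges F (k + 1) u \ ballEdges F k u
    active := decide (k = 0 ∨ ballEdges F (k + 1) u ≠ ballEdges F k u) }
  time : ∀ u, N.time u ≤ T u + (Fintype.card V + 3) + k * (3 * Fintype.card V + 2) + traffic F k u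

/-- The state of the network after the propagation. -/
structure KnowledgeState (F added : Finset (V × V)) (T : V → ℕ) (N : Net V) : Prop where
  stage : N.stage = .classification
  added_eq : N.added = added
  role : ∀ u, (N.agent u).role = .idle
  known : ∀ u, (N.agent u).known = knownEdges F u
  active : ∀ u, (N.agent u).active = false
  offer : ∀ u, (N.agent u).offer = ∅
  choice : ∀ u, (N.agent u).choice = none
  time : ∀ u, N.time u ≤ T u + (Fintype.card V + 3) +
    Fintype.card V * (3 * Fintype.card V + 2) + 2 * (Fintype.card V * F.card)

theorem start_step {n : ℕ} (hst : (run E ord n).stage = .start)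
    (hrole : ∀ u, ((run E ord n).agent u).role ≠ .exited) :
    PropagationState (E ∪ (run E ord n).added) (run E ord n).added (run E ord n).time 0
      (run E ord (n + 1)) := by
  set N := run E ord n
  set F := E ∪ N.added with hF
  have e : run E ord (n + 1) = N.exec .propagation fun u => beginRound u (outNbrs F u) := by
    show Net.step E ord n N = _
    unfold Net.step
    rw [hst]
  rw [e, Net.exec_eq _ _ _ hrole]
  choose x hx1 hx2 hx3 using fun u => beginRound_spec u (outNbrs F u)
  refine ⟨rfl, ?_, fun u => ?_, fun u => ?_⟩
  · simp [hx1]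
  · have h0 : ballEdges F 0 u = ∅ := by simp [ballEdges, ball]
    have h1 : x u = ballEdges F 1 u := by
      ext e
      rw [hx2, ballEdges_one]
    simp [hx1, h0, h1]
  · have h1 := hx3 u
    have h2 : (outNbrs F u).card ≤ Fintype.card V := Finset.card_le_univ _
    simp only
    omega

/-- Agents that have left the loop still fit the formulas of `PropagationState`: their balls are
stable and their difference sets empty, which agrees with their sending nothing. -/
theorem propagation_step {n k : ℕ} {A : Finset (V × V)} {T : V → ℕ}
    (h : PropagationState (E ∪ A) A T k (run E ord n))
    (hact : ∃ u, ((run E ord n).agent u).active = true) :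
    PropagationState (E ∪ A) A T (k + 1) (run E ord (n + 1)) := by
  set N := run E ord n
  set F := E ∪ A with hF
  have e : run E ord (n + 1) = N.exec .propagation fun u =>
        propagate (N.agent u) (outNbrs F u) (inNbrs F u) fun v =>
          if (N.agent v).active then (N.agent v).fresh else ∅ := by
    show Net.step E ord n N = _
    unfold Net.step
    rw [h.stage, h.added_eq]
    simp only [hact, if_true]
    rfl
  have hmsg : (fun v => if (N.agent v).active then (N.agent v).fresh else ∅) =
      fun v => ballEdges F (k + 1) v \ ballEdges F k v := by
    funext v
    rw [h.agent v]
    by_cases hv : ballEdges F (k + 1) v = ballEdges F k v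
    · simp [hv]
    · simp [hv]
  rw [e, hmsg, Net.exec_eq _ _ _ fun u => by rw [h.agent u]; simp [Agent.initial]]
  have key : ∀ u, (propagate (N.agent u) (outNbrs F u) (inNbrs F u)
      fun v => ballEdges F (k + 1) v \ ballEdges F k v).val =
      ({ Agent.initial V with
          known := ballEdges F (k + 2) u
          fresh := ballEdges F (k + 2) u \ ballEdges F (k + 1) u
          active := decide (k + 1 = 0 ∨ ballEdges F (k + 2) u ≠ ballEdges F (k + 1) u) }, ∅) ∧
      (propagate (N.agent u) (outNbrs F u) (inNbrs F u)
        fun v => ballEdges F (k + 1) v \ ballEdges F k v).steps ≤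
      3 * Fintype.card V + 2 +
      (Fintype.card V * (ballEdges F (k + 1) u \ ballEdges F k u).card +
        ∑ v ∈ inNbrs F u, (ballEdges F (k + 1) v \ ballEdges F k v).card) := by
    intro u
    by_cases hu : (N.agent u).active = true
    · obtain ⟨h1, h2⟩ := propagate_spec (N.agent u) (outNbrs F u) (inNbrs F u)
        (fun v => ballEdges F (k + 1) v \ ballEdges F k v) hu
      constructor
      · rw [h1]
        have e1 := ballEdges_union_biUnion F k u
        have e2 : (inNbrs F u).biUnion (fun v => ballEdges F (k + 1) v \ ballEdges F k v) \
            ballEdges F (k + 1) u = ballEdges F (k + 2) u \ ballEdges F (k + 1) u := by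
          rw [← e1, Finset.union_sdiff_left]
        have e3 : ballEdges F (k + 2) u \ ballEdges F (k + 1) u = ∅ ↔
            ballEdges F (k + 2) u = ballEdges F (k + 1) u := by
          rw [Finset.sdiff_eq_empty_iff_subset]
          exact ⟨fun hs => hs.antisymm (ballEdges_subset_succ F (k + 1) u), fun hs => hs.le⟩
        rw [h.agent u]
        simp only [e1, e2, e3]
        simp
      · refine h2.trans ?_
        have h3 : (outNbrs F u).card ≤ Fintype.card V := Finset.card_le_univ _
        have h4 : (inNbrs F u).card ≤ Fintype.card V := Finset.card_le_univ _
        have h5 : (N.agent u).fresh = ballEdges F (k + 1) u \ ballEdges F k u := by rw [h.agent u]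
        rw [h5]
        have h6 := Nat.mul_le_mul_right ((ballEdges F (k + 1) u \ ballEdges F k u).card + 1) h3
        rw [Nat.mul_add (Fintype.card V)] at h6
        omega
    · have e1 : propagate (N.agent u) (outNbrs F u) (inNbrs F u)
          (fun v => ballEdges F (k + 1) v \ ballEdges F k v) = ⟨(N.agent u, ∅), 1⟩ := by
        unfold propagate
        rw [if_neg hu]
        rfl
      rw [e1]
      have e2 : k ≠ 0 ∧ ballEdges F (k + 1) u = ballEdges F k u := by
        rw [h.agent u] at hu
        simp only [decide_eq_true_eq, not_or, not_not] at hu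
        exact hu
      obtain ⟨hk, e3⟩ := e2
      -- An inactive agent has made at least one pass, so the useless comparison with the empty ball
      -- does not occur.
      obtain ⟨j, rfl⟩ := Nat.exists_eq_succ_of_ne_zero hk
      have e4 := ball_stable (ball_eq_of_ballEdges_eq e3)
      have e5 : ballEdges F (j + 1 + 2) u = ballEdges F (j + 1 + 1) u := by
        unfold ballEdges
        rw [e4]
      constructor
      · rw [h.agent u]
        simp [e3, e5]
      · simp only
        omega
  refine ⟨rfl, ?_, fun u => congrArg Prod.fst (key u).1, fun u => ?_⟩
  · simp [key, h.added_eq]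
  · have h1 := h.time u
    have h2 := (key u).2
    rw [traffic_succ]
    simp only
    rw [Nat.add_mul, one_mul]
    omega

theorem propagation_end {n k : ℕ} {A : Finset (V × V)} {T : V → ℕ} (hk : k ≤ Fintype.card V)
    (h : PropagationState (E ∪ A) A T k (run E ord n))
    (hact : ¬ ∃ u, ((run E ord n).agent u).active = true) :
    KnowledgeState (E ∪ A) A T (run E ord (n + 1)) := by
  set N := run E ord n
  set F := E ∪ A with hF
  have e : run E ord (n + 1) = { N with stage := .classification } := by
    show Net.step E ord n N = _
    unfold Net.step
    rw [h.stage]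
    simp only [hact, if_false]
  have hinact : ∀ u, (N.agent u).active = false := by
    intro u
    by_contra hu
    exact hact ⟨u, by simpa using hu⟩
  rw [e]
  refine ⟨rfl, h.added_eq, fun u => ?_, fun u => ?_, hinact, fun u => ?_, fun u => ?_, fun u => ?_⟩
  · simp [h.agent u, Agent.initial]
  · have hu := hinact u
    rw [h.agent u] at hu
    simp only [decide_eq_false_iff_not, not_or, not_not] at hu
    obtain ⟨j, rfl⟩ := Nat.exists_eq_succ_of_ne_zero hu.1
    simp only [h.agent u]
    exact ballEdges_eq_knownEdges hu.2
  · simp [h.agent u, Agent.initial]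
  · simp [h.agent u, Agent.initial]
  · have h1 := h.time u
    have h2 := traffic_le F k u
    have h3 := Nat.mul_le_mul_right (3 * Fintype.card V + 2) hk
    simp only
    omega

/-- The propagation ends after at most `|V|` passes. -/
theorem propagation_terminates [Nonempty V] {A : Finset (V × V)} {T : V → ℕ} (d : ℕ) :
    ∀ n k : ℕ, k ≤ Fintype.card V → Fintype.card V ≤ k + d →
      PropagationState (E ∪ A) A T k (run E ord n) →
      ∃ m, KnowledgeState (E ∪ A) A T (run E ord m) := by
  have hpos : 0 < Fintype.card V := Fintype.card_pos
  have hlt : ∀ n k : ℕ, PropagationState (E ∪ A) A T k (run E ord n) →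
      (∃ u, ((run E ord n).agent u).active = true) → k < Fintype.card V := by
    rintro n k h ⟨u, hu⟩
    rw [h.agent u] at hu
    simp only [decide_eq_true_eq] at hu
    rcases hu with rfl | hu
    · exact hpos
    · have h1 : ball (E ∪ A) (k + 1) u ≠ ball (E ∪ A) k u := fun h' => hu (by
        unfold ballEdges; rw [h'])
      have h2 := le_card_of_ball_ne h1
      have h3 : (ball (E ∪ A) (k + 1) u).card ≤ Fintype.card V := Finset.card_le_univ _
      omega
  induction d with
  | zero =>
    intro n k hk hd h
    by_cases hact : ∃ u, ((run E ord n).agent u).active = true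
    · have := hlt n k h hact
      omega
    · exact ⟨n + 1, propagation_end hk h hact⟩
  | succ d ih =>
    intro n k hk hd h
    by_cases hact : ∃ u, ((run E ord n).agent u).active = true
    · have := hlt n k h hact
      exact ih (n + 1) (k + 1) (by omega) (by omega) (propagation_step h hact)
    · exact ⟨n + 1, propagation_end hk h hact⟩

/-- A bound for the time that an agent spends in a round on a digraph with `n` nodes and `m` edges. -/
def roundCost (n m : ℕ) : ℕ := 60 * (n * n + n * m)

open Classical in
/-- The state of the network after the classification. -/
structure RoleState (F added : Finset (V × V)) (T : V → ℕ) (N : Net V) : Prop where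
  stage : N.stage = .second
  added_eq : N.added = added
  role : ∀ u, (N.agent u).role = if (∀ w, Reach F w u ↔ Reach F u w) then .exited
        else if IsSrc F u then .source else if IsTgt F u then .target else .idle
  known : ∀ u, (N.agent u).known = knownEdges F u
  components : ∀ u, Components F u (N.agent u).scc
  active : ∀ u, (N.agent u).active = false
  offer : ∀ u, (N.agent u).offer = ∅
  choice : ∀ u, (N.agent u).choice = none
  time : ∀ u, N.time u ≤ T u + 3 * (Fintype.card V * Fintype.card V) +
    2 * (Fintype.card V * F.card) + 10 * Fintype.card V + 4 * F.card + 9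

theorem classification_step {n : ℕ} {A : Finset (V × V)} {T : V → ℕ}
    (h : KnowledgeState (E ∪ A) A T (run E ord n)) :
    RoleState (E ∪ A) A T (run E ord (n + 1)) := by
  set N := run E ord n
  set F := E ∪ A with hF
  have e : run E ord (n + 1) = N.exec .second fun u => classify u (N.agent u) := by
    show Net.step E ord n N = _
    unfold Net.step
    rw [h.stage]
  rw [e, Net.exec_eq _ _ _ fun u => by rw [h.role u]; simp]
  choose s role h1 h2 h3 h4 using fun u => classify_spec F u (N.agent u) (h.known u)
  refine ⟨rfl, by simp [h1, h.added_eq], fun u => ?_, fun u => ?_, fun u => ?_, fun u => ?_,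
    fun u => ?_, fun u => ?_, fun u => ?_⟩
  · simp only [h1, h3]
  · simp only [h1, h.known]
  · simp only [h1, h2]
  · simp only [h1, h.active]
  · simp only [h1, h.offer]
  · simp only [h1, h.choice]
  · have k1 := h.time u
    have k2 := h4 u
    have k3 : Fintype.card V * (3 * Fintype.card V + 2) =
      3 * (Fintype.card V * Fintype.card V) + 2 * Fintype.card V := by ring
    simp only
    omega

/-- Every round gets as far as the end of the classification. -/
theorem reach_roleState [Nonempty V] {n : ℕ} (hst : (run E ord n).stage = .start)
    (hrole : ∀ u, ((run E ord n).agent u).role ≠ .exited) :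
    ∃ m, RoleState (E ∪ (run E ord n).added) (run E ord n).added (run E ord n).time
      (run E ord m) := by
  obtain ⟨m, hm⟩ := propagation_terminates (Fintype.card V) (n + 1) 0 (by omega) (by omega)
    (start_step hst hrole)
  exact ⟨m + 1, classification_step hm⟩

/-- The state of the network after Phase 4. -/
structure RoundEnd (F added : Finset (V × V)) (T : V → ℕ) (N : Net V) : Prop where
  stage : N.stage = .start
  role : ∀ u, (N.agent u).role ≠ .exited
  added_eq : ∃ A c, Augmentation F A c ∧ N.added = added ∪ A
  time : ∀ u, N.time u ≤ T u + roundCost (Fintype.card V) F.card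

omit [Fintype V] [LinearOrder V] in
theorem mem_order (ord : DeliveryOrder V) (n : ℕ) (u : V) (s : Finset V) (v : V) :
    v ∈ ord.order n u s ↔ v ∈ s := by
  rw [← Multiset.mem_coe, ord.isEnum]
  rfl

omit [Fintype V] [LinearOrder V] in
theorem nodup_order (ord : DeliveryOrder V) (n : ℕ) (u : V) (s : Finset V) :
    (ord.order n u s).Nodup := by
  rw [← Multiset.coe_nodup, ord.isEnum]
  exact s.nodup

/-- Nobody exits, so the roles are exactly those of sources and targets. The set `R t` consists of
the sources that reach the target `t`, and the inbox of `s` of the targets that `s` reaches. The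
tests for more than one element thus ask for a second source or a second target, which is what
`Augmentation` expresses. -/
theorem phases_step {n : ℕ} {A : Finset (V × V)} {T : V → ℕ}
    (hwc : WeaklyConnected (E ∪ A)) (hn : ¬ StronglyConnected (E ∪ A))
    (h : RoleState (E ∪ A) A T (run E ord n)) :
    RoundEnd (E ∪ A) A T (run E ord (n + 3)) := by
  classical
  set N := run E ord n
  set F := E ∪ A with hF
  have hex : ∀ u, ¬ ∀ w, Reach F w u ↔ Reach F u w := fun u hu =>
    hn (hwc.stronglyConnected_of_mutual hu)
  have hsrc : ∀ u, (N.agent u).role = .source ↔ IsSrc F u := by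
    intro u
    rw [h.role u, if_neg (hex u)]
    by_cases h1 : IsSrc F u
    · simp [h1]
    · by_cases h2 : IsTgt F u <;> simp [h1, h2]
  have htgt : ∀ u, (N.agent u).role = .target ↔ IsTgt F u := by
    intro u
    rw [h.role u, if_neg (hex u)]
    by_cases h1 : IsSrc F u
    · have h2 : ¬ IsTgt F u := fun h2 => hex u fun w =>
        ⟨fun hw => (h1 w hw).1, fun hw => (h2 w hw).1⟩
      simp [h1, h2]
    · by_cases h2 : IsTgt F u <;> simp [h1, h2]
  have hne : ∀ u, (N.agent u).role ≠ .exited := by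
    intro u
    rw [h.role u, if_neg (hex u)]
    split_ifs <;> simp
  -- Phase 2
  have h2 : ∀ u, ∃ R : Finset V, (phase2 (N.agent u)).val = ({ N.agent u with offer := R }, ∅) ∧
      (∀ s, s ∈ R ↔ IsTgt F u ∧ IsSrc F s ∧ Reach F s u) ∧
      (phase2 (N.agent u)).steps ≤
        F.card + 5 * Fintype.card V + Fintype.card V * Fintype.card V + 4 := by
    intro u
    by_cases hu : (N.agent u).role = .target
    · obtain ⟨R, k1, k2, k3⟩ := phase2_spec F u (N.agent u) (h.known u) (h.components u) hu
      refine ⟨R, k1, fun s => ?_, k3⟩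
      rw [k2]
      simp [(htgt u).1 hu]
    · have e1 : phase2 (N.agent u) = ⟨(N.agent u, ∅), 1⟩ := by
        unfold phase2
        rw [if_neg hu]
        rfl
      rw [e1]
      refine ⟨∅, ?_, fun s => ?_, by simp only; omega⟩
      · rw [← h.offer u]
      · rw [htgt] at hu
        simp [hu]
  choose R hR1 hR2 hR3 using h2
  have e2 : run E ord (n + 1) = N.exec .third fun u => phase2 (N.agent u) := by
    show Net.step E ord n N = _
    unfold Net.step
    rw [h.stage]
  rw [Net.exec_eq _ _ _ hne] at e2
  simp only [hR1] at e2
  set N2 := run E ord (n + 1)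
  have hoffer : ∀ u, (N2.agent u).offer = R u := fun u => by rw [e2]
  have hag2 : ∀ u, N2.agent u = { N.agent u with offer := R u } := fun u => by rw [e2]
  have hrole2 : ∀ u, (N2.agent u).role = (N.agent u).role := fun u => by rw [hag2]
  -- Phase 3
  set inbox := fun u => ord.order (n + 1) u (Finset.univ.filter fun t => u ∈ (N2.agent t).offer)
    with hinbox
  have hmem : ∀ u t, t ∈ inbox u ↔ IsTgt F t ∧ IsSrc F u ∧ Reach F u t := by
    intro u t
    rw [hinbox, mem_order, Finset.mem_filter, hoffer, hR2]
    simp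
  have h3 : ∀ u, ∃ (P : Finset V) (c : Option V) (B : Finset (V × V)),
      (phase3 u (N2.agent u) (inbox u) fun t => (N2.agent t).offer).val =
        ({ N2.agent u with proposers := P, choice := c }, B) ∧
      (IsSrc F u → ∀ t, t ∈ P ↔ t ∈ inbox u) ∧
      ((∃ t ∈ inbox u, 1 < (R t).card ∧ c = some t ∧ B = ∅) ∨
        ((∀ t ∈ inbox u, (R t).card ≤ 1) ∧ c = none ∧ ∀ e, e ∈ B ↔ ∃ t ∈ inbox u, (t, u) = e)) ∧
      (phase3 u (N2.agent u) (inbox u) fun t => (N2.agent t).offer).steps ≤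
        Fintype.card V * Fintype.card V + 4 * Fintype.card V + 4 := by
    intro u
    have hcn : (N2.agent u).choice = none := by rw [hag2]; exact h.choice u
    by_cases hu : (N2.agent u).role = .source
    · obtain ⟨P, c, B, k1, k2, k3, k4⟩ := phase3_spec u (N2.agent u) (inbox u)
        (fun t => (N2.agent t).offer) hu hcn (nodup_order _ _ _ _)
      refine ⟨P, c, B, k1, fun _ => k2, ?_, k4⟩
      simpa only [hoffer] using k3
    · have e1 : (phase3 u (N2.agent u) (inbox u) fun t => (N2.agent t).offer) =
          ⟨(N2.agent u, ∅), 1⟩ := by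
        unfold phase3
        rw [if_neg hu]
        rfl
      rw [hrole2, hsrc] at hu
      have hemp : ∀ t, t ∉ inbox u := fun t ht => hu ((hmem u t).1 ht).2.1
      rw [e1]
      refine ⟨(N2.agent u).proposers, none, ∅, ?_, fun hs => absurd hs hu,
        .inr ⟨fun t ht => absurd ht (hemp t), rfl, fun e => ?_⟩, by simp only; omega⟩
      · rw [← hcn]
      · simp [hemp]
  choose P c B hP1 hP2 hP3 hP4 using h3
  have e3 : run E ord (n + 1 + 1) = N2.exec .fourth
      fun u => phase3 u (N2.agent u) (inbox u) fun t => (N2.agent t).offer := by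
    show Net.step E ord (n + 1) N2 = _
    unfold Net.step
    have : N2.stage = .third := by rw [e2]
    rw [this]
  rw [Net.exec_eq _ _ _ fun u => by rw [hrole2]; exact hne u] at e3
  simp only [hP1] at e3
  set N3 := run E ord (n + 1 + 1)
  have hag3 : ∀ u, N3.agent u = { N2.agent u with proposers := P u, choice := c u } := fun u => by
    rw [e3]
  have hrole3 : ∀ u, (N3.agent u).role = (N.agent u).role := fun u => by rw [hag3]; exact hrole2 u
  have hcm : ∀ s t, c s = some t → IsSrc F s ∧ IsTgt F t ∧ Reach F s t ∧ 1 < (R t).card := by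
    intro s t hst
    rcases hP3 s with ⟨t', k1, k2, k3, -⟩ | ⟨-, k1, -⟩
    · rw [hst] at k3
      simp only [Option.some.injEq] at k3
      subst k3
      have := (hmem s t).1 k1
      exact ⟨this.2.1, this.1, this.2.2, k2⟩
    · rw [hst] at k1; simp at k1
  -- Phase 4
  set inbox4 := fun u => ord.order (n + 1 + 1) u
    (Finset.univ.filter fun s => (N3.agent s).choice = some u) with hinbox4
  have hmem4 : ∀ u s, s ∈ inbox4 u ↔ c s = some u := by
    intro u s
    rw [hinbox4, mem_order, Finset.mem_filter, hag3]
    simp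
  have h4 : ∀ u, ∃ D : Finset (V × V),
      (phase4 u (N3.agent u) (inbox4 u) fun s => (N3.agent s).proposers).val = (N3.agent u, D) ∧
      ((∃ s ∈ inbox4 u, 1 < (P s).card ∧ D = {(u, s)}) ∨
        ((∀ s ∈ inbox4 u, (P s).card ≤ 1) ∧ ∀ e, e ∈ D ↔ ∃ s ∈ inbox4 u, (u, s) = e)) ∧
      (phase4 u (N3.agent u) (inbox4 u) fun s => (N3.agent s).proposers).steps ≤
        Fintype.card V * Fintype.card V + 4 * Fintype.card V + 4 := by
    intro u
    by_cases hu : (N3.agent u).role = .target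
    · obtain ⟨D, k1, k2, k3⟩ := phase4_spec u (N3.agent u) (inbox4 u)
        (fun s => (N3.agent s).proposers) hu (nodup_order _ _ _ _)
      have hPr : ∀ s, (N3.agent s).proposers = P s := fun s => by rw [hag3]
      exact ⟨D, k1, by simpa only [hPr] using k2, k3⟩
    · have e1 : (phase4 u (N3.agent u) (inbox4 u) fun s => (N3.agent s).proposers) =
          ⟨(N3.agent u, ∅), 1⟩ := by
        unfold phase4
        rw [if_neg hu]
        rfl
      rw [hrole3, htgt] at hu
      have hemp : ∀ s, s ∉ inbox4 u := fun s hs => hu (hcm s u ((hmem4 u s).1 hs)).2.1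
      rw [e1]
      exact ⟨∅, rfl, .inr ⟨fun s hs => absurd hs (hemp s), fun e => by simp [hemp]⟩,
        by simp only; omega⟩
  choose D hD1 hD2 hD3 using h4
  have e4 : run E ord (n + 1 + 1 + 1) = N3.exec .start
      fun u => phase4 u (N3.agent u) (inbox4 u) fun s => (N3.agent s).proposers := by
    show Net.step E ord (n + 1 + 1) N3 = _
    unfold Net.step
    have : N3.stage = .fourth := by rw [e3]
    rw [this]
  rw [Net.exec_eq _ _ _ fun u => by rw [hrole3]; exact hne u] at e4
  simp only [hD1] at e4
  rw [show n + 3 = n + 1 + 1 + 1 from rfl, e4]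
  refine ⟨rfl, fun u => ?_, ?_, fun u => ?_⟩
  · rw [hrole3 u]; exact hne u
  · have hadd3 : N3.added = A ∪ Finset.univ.biUnion B := by
      rw [e3]
      simp only [e2, h.added_eq]
      ext e
      simp
    refine ⟨Finset.univ.biUnion B ∪ Finset.univ.biUnion D, c, ?_, by
      simp only [hadd3, Finset.union_assoc]⟩
    have hB : ∀ t s, (t, s) ∈ Finset.univ.biUnion B ↔ c s = none ∧ t ∈ inbox s := by
      intro t s
      simp only [Finset.mem_biUnion, Finset.mem_univ, true_and]
      constructor
      · rintro ⟨x, hx⟩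
        rcases hP3 x with ⟨_, -, -, -, k⟩ | ⟨-, k1, k2⟩
        · rw [k] at hx; simp at hx
        · obtain ⟨y, hy, hxy⟩ := (k2 _).1 hx
          simp only [Prod.mk.injEq] at hxy
          obtain ⟨rfl, rfl⟩ := hxy
          exact ⟨k1, hy⟩
      · rintro ⟨h1, h2⟩
        refine ⟨s, ?_⟩
        rcases hP3 s with ⟨_, -, -, k, -⟩ | ⟨-, -, k2⟩
        · rw [h1] at k; simp at k
        · exact (k2 _).2 ⟨t, h2, rfl⟩
    have hPmem : ∀ s t t', c s = some t → (t' ∈ P s ↔ IsTgt F t' ∧ Reach F s t') := by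
      intro s t t' hst
      rw [hP2 s (hcm s t hst).1, hmem]
      simp [(hcm s t hst).1]
    constructor
    · intro s t hst
      obtain ⟨k1, k2, k3, k4⟩ := hcm s t hst
      obtain ⟨s', hs', hne'⟩ := Finset.exists_mem_ne k4 s
      rw [hR2] at hs'
      exact ⟨k1, k2, k3, s', hne', hs'.2⟩
    · intro s hs hcs t ht hst s' hs' hst'
      rcases hP3 s with ⟨_, -, -, k, -⟩ | ⟨k1, -, -⟩
      · rw [hcs] at k; simp at k
      · exact Finset.card_le_one.1 (k1 t ((hmem s t).2 ⟨ht, hs, hst⟩)) _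
          ((hR2 t s').2 ⟨ht, hs', hst'⟩) _ ((hR2 t s).2 ⟨ht, hs, hst⟩)
    · intro t s hts
      rcases Finset.mem_union.1 hts with hts | hts
      · obtain ⟨k1, k2⟩ := (hB t s).1 hts
        have := (hmem s t).1 k2
        exact .inl ⟨k1, this.2.1, this.1, this.2.2⟩
      · right
        simp only [Finset.mem_biUnion, Finset.mem_univ, true_and] at hts
        obtain ⟨x, hx⟩ := hts
        rcases hD2 x with ⟨y, k1, -, k2⟩ | ⟨-, k1⟩
        · rw [k2, Finset.mem_singleton, Prod.mk.injEq] at hx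
          rw [hx.1, hx.2]
          exact (hmem4 x y).1 k1
        · obtain ⟨y, hy, hxy⟩ := (k1 _).1 hx
          simp only [Prod.mk.injEq] at hxy
          rw [← hxy.1, ← hxy.2]
          exact (hmem4 x y).1 hy
    · intro s hs hcs t ht hst
      exact Finset.mem_union_left _ ((hB t s).2 ⟨hcs, (hmem s t).2 ⟨ht, hs, hst⟩⟩)
    · intro s t hst
      rcases hD2 t with ⟨y, k1, k2, k3⟩ | ⟨k1, k2⟩
      · left
        have hy := (hmem4 t y).1 k1
        obtain ⟨t', ht', hne'⟩ := Finset.exists_mem_ne k2 t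
        refine ⟨y, hy, Finset.mem_union_right _ (Finset.mem_biUnion.2 ⟨t, Finset.mem_univ _, ?_⟩),
          t', hne', (hPmem y t t' hy).1 ht'⟩
        rw [k3]; simp
      · right
        intro s' hs'
        have hs4 := (hmem4 t s').2 hs'
        refine ⟨Finset.mem_union_right _ (Finset.mem_biUnion.2 ⟨t, Finset.mem_univ _,
          (k2 _).2 ⟨s', hs4, rfl⟩⟩), fun t' ht' hst' => ?_⟩
        have hc' := hcm s' t hs'
        exact Finset.card_le_one.1 (k1 s' hs4) _ ((hPmem s' t t' hs').2 ⟨ht', hst'⟩) _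
          ((hPmem s' t t hs').2 ⟨hc'.2.1, hc'.2.2.1⟩)
  · have t1 := h.time u
    have t2 := hR3 u
    have t3 := hP4 u
    have t4 := hD3 u
    have t5 : N2.time u = N.time u + (phase2 (N.agent u)).steps := by rw [e2]
    have t6 : N3.time u = N2.time u +
      (phase3 u (N2.agent u) (inbox u) fun t => (N2.agent t).offer).steps := by rw [e3]
    -- With `v = |V|` and `f = |F|` the contributions add up to `6v² + 2vf + 23v + 5f + 21`; the
    -- lower terms are absorbed by `v²` and `vf`.
    have hV : 1 ≤ Fintype.card V := Fintype.card_pos_iff.2 ⟨u⟩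
    have hV1 : Fintype.card V ≤ Fintype.card V * Fintype.card V := Nat.le_mul_of_pos_left _ hV
    have hV2 : F.card ≤ Fintype.card V * F.card := Nat.le_mul_of_pos_left _ hV
    unfold roundCost
    simp only
    omega

end Round

/-! ### The whole run -/

section Run

variable {V : Type} [Fintype V] [LinearOrder V] {E : Finset (V × V)} {ord : DeliveryOrder V}

theorem Net.le_exec_time (N : Net V) (next : Stage)
    (prog : V → Timed (Agent V × Finset (V × V))) (u : V) :
    N.time u ≤ (N.exec next prog).time u :=
  Nat.le_add_right _ _

theorem time_le_succ (E : Finset (V × V)) (ord : DeliveryOrder V) (n : ℕ) (u : V) :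
    (run E ord n).time u ≤ (run E ord (n + 1)).time u := by
  show _ ≤ (Net.step E ord n (run E ord n)).time u
  unfold Net.step
  split
  · exact Net.le_exec_time _ _ _ _
  · split_ifs
    · exact Net.le_exec_time _ _ _ _
    · exact le_rfl
  · exact Net.le_exec_time _ _ _ _
  · exact Net.le_exec_time _ _ _ _
  · exact Net.le_exec_time _ _ _ _
  · exact Net.le_exec_time _ _ _ _

/-- All agents have exited, and none is inside the propagation. -/
def Net.Exited (N : Net V) : Prop :=
  ∀ u, (N.agent u).role = .exited ∧ (N.agent u).active = false

theorem Net.Exited.exec {N : Net V} (h : N.Exited) (next : Stage)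
    (prog : V → Timed (Agent V × Finset (V × V))) :
    (N.exec next prog).Exited ∧ (N.exec next prog).time = N.time := by
  have h' : ∀ u, (N.agent u).role = .exited := fun u => (h u).1
  unfold Net.exec
  simp only [h', if_true]
  exact ⟨h, rfl⟩

theorem exited_succ {n : ℕ} (h : (run E ord n).Exited) :
    (run E ord (n + 1)).Exited ∧ (run E ord (n + 1)).time = (run E ord n).time := by
  show (Net.step E ord n (run E ord n)).Exited ∧ (Net.step E ord n (run E ord n)).time = _
  unfold Net.step
  split
  · exact h.exec _ _
  · split_ifs
    · exact h.exec _ _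
    · exact ⟨h, rfl⟩
  · exact h.exec _ _
  · exact h.exec _ _
  · exact h.exec _ _
  · exact h.exec _ _

/-- Times never decrease, and they are frozen once everybody has exited. -/
theorem time_le_of_exited {m : ℕ} (h : (run E ord m).Exited) (n : ℕ) (u : V) :
    (run E ord n).time u ≤ (run E ord m).time u := by
  rcases le_total n m with hnm | hnm
  · exact monotone_nat_of_le_succ (f := fun n => (run E ord n).time u)
      (fun n => time_le_succ E ord n u) hnm
  · have : (run E ord n).Exited ∧ (run E ord n).time = (run E ord m).time := by
      induction n, hnm using Nat.le_induction with
      | base => exact ⟨h, rfl⟩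
      | succ n _ ih =>
        have := exited_succ ih.1
        exact ⟨this.1, this.2.trans ih.2⟩
    rw [this.2]

theorem roundCost_mono (n : ℕ) {m m' : ℕ} (h : m ≤ m') : roundCost n m ≤ roundCost n m' := by
  unfold roundCost
  gcongr

theorem exit_of_stronglyConnected [Nonempty V] {n : ℕ} (hst : (run E ord n).stage = .start)
    (hrole : ∀ u, ((run E ord n).agent u).role ≠ .exited)
    (hsc : StronglyConnected (E ∪ (run E ord n).added)) :
    ∃ m, (run E ord m).Exited ∧ ∀ u, (run E ord m).time u ≤ (run E ord n).time u +
      roundCost (Fintype.card V) (E ∪ (run E ord n).added).card := by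
  obtain ⟨m, hm⟩ := reach_roleState hst hrole
  refine ⟨m, fun u => ⟨?_, hm.active u⟩, fun u => ?_⟩
  · rw [hm.role u, if_pos fun w => ⟨fun _ => hsc u w, fun _ => hsc w u⟩]
  · have h1 := hm.time u
    have hV : 1 ≤ Fintype.card V := Fintype.card_pos
    have hV1 : Fintype.card V ≤ Fintype.card V * Fintype.card V := Nat.le_mul_of_pos_left _ hV
    have hV2 := Nat.le_mul_of_pos_left (E ∪ (run E ord n).added).card hV
    unfold roundCost
    omega

theorem round_of_not_stronglyConnected [Nonempty V] {n : ℕ}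
    (hst : (run E ord n).stage = .start)
    (hrole : ∀ u, ((run E ord n).agent u).role ≠ .exited)
    (hwc : WeaklyConnected (E ∪ (run E ord n).added))
    (hsc : ¬ StronglyConnected (E ∪ (run E ord n).added)) :
    ∃ m, RoundEnd (E ∪ (run E ord n).added) (run E ord n).added (run E ord n).time
      (run E ord m) := by
  obtain ⟨m, hm⟩ := reach_roleState hst hrole
  exact ⟨m + 3, phases_step hwc hsc hm⟩

/-- From the start of a round on, the number of rounds is at most one plus the smaller one of the numbers
of source and of target components. -/
theorem exists_exited [Nonempty V] (hwc : WeaklyConnected E) (k : ℕ) :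
    ∀ n : ℕ, (run E ord n).stage = .start →
    (∀ u, ((run E ord n).agent u).role ≠ .exited) →
    ¬ StronglyConnected (E ∪ (run E ord n).added) →
    (run E ord n).added.card + 2 * (srcs (E ∪ (run E ord n).added)).card ≤ 2 * Fintype.card V →
    min (srcs (E ∪ (run E ord n).added)).card (tgts (E ∪ (run E ord n).added)).card ≤ k →
    ∃ m, (run E ord m).Exited ∧ ∀ u, (run E ord m).time u ≤ (run E ord n).time u +
      (k + 1) * roundCost (Fintype.card V) (E.card + 3 * Fintype.card V) := by
  induction k with
  | zero =>
    intro n _ _ _ _ hk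
    exfalso
    obtain ⟨v⟩ := ‹Nonempty V›
    obtain ⟨s, hs, -⟩ := exists_isSrc (E ∪ (run E ord n).added) v
    obtain ⟨t, ht, -⟩ := exists_isTgt (E ∪ (run E ord n).added) v
    have h1 := Finset.card_pos.2 ⟨s, mem_srcs.2 hs⟩
    have h2 := Finset.card_pos.2 ⟨t, mem_tgts.2 ht⟩
    omega
  | succ k ih =>
    intro n hst hrole hsc hadd hk
    have hwc' := hwc.mono (Finset.subset_union_left (s₂ := (run E ord n).added))
    obtain ⟨m, hm⟩ := round_of_not_stronglyConnected hst hrole hwc' hsc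
    obtain ⟨A, c, hA, hAdd⟩ := hm.added_eq
    have hF : E ∪ (run E ord m).added = E ∪ (run E ord n).added ∪ A := by
      rw [hAdd, Finset.union_assoc]
    have hcard1 := Finset.card_union_le E (run E ord n).added
    -- The budget allows at most `2|V|` edges added so far; a round that makes the digraph strongly
    -- connected may exceed it by another `|V|`, whence `3|V|`.
    have hcost1 := roundCost_mono (Fintype.card V)
      (show (E ∪ (run E ord n).added).card ≤ E.card + 3 * Fintype.card V by omega)
    have hcardA := Finset.card_union_le (run E ord n).added A
    rw [← hAdd] at hcardA
    have hprog := hA.progress hwc'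
    rw [← hF] at hprog
    by_cases hsc' : StronglyConnected (E ∪ (run E ord m).added)
    · obtain ⟨m', hm', ht⟩ := exit_of_stronglyConnected hm.stage hm.role hsc'
      have hcard2 := Finset.card_union_le E (run E ord m).added
      have hcost2 := roundCost_mono (Fintype.card V)
        (show (E ∪ (run E ord m).added).card ≤ E.card + 3 * Fintype.card V by
          rcases hprog with ⟨_, h⟩ | ⟨_, _, h⟩ <;> omega)
      refine ⟨m', hm', fun u => ?_⟩
      have t1 := ht u
      have t2 := hm.time u
      -- The present round, and one in which all agents find the digraph strongly connected.
      have t3 : 2 * roundCost (Fintype.card V) (E.card + 3 * Fintype.card V) ≤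
          (k + 1 + 1) * roundCost (Fintype.card V) (E.card + 3 * Fintype.card V) :=
        Nat.mul_le_mul_right _ (by omega)
      omega
    · obtain ⟨h1, h2, h3⟩ := hprog.resolve_left fun h => hsc' h.1
      obtain ⟨m', hm', ht⟩ := ih m hm.stage hm.role hsc' (by omega) (by omega)
      refine ⟨m', hm', fun u => ?_⟩
      have t1 := ht u
      have t2 := hm.time u
      rw [Nat.add_mul (k + 1), one_mul]
      omega

end Run

end DigraphAug

theorem mainTheorem4 :
    ∃ C : ℕ, ∀ (V : Type) [Fintype V] [LinearOrder V] (E : Finset (V × V)),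
      DigraphAug.WeaklyConnected E → ¬ DigraphAug.StronglyConnected E →
      ∀ ord : DigraphAug.DeliveryOrder V,
        (∃ n, ∀ u, ((DigraphAug.run E ord n).agent u).role = DigraphAug.Role.exited) ∧
        ∀ n u, (DigraphAug.run E ord n).time u ≤
          C * (Fintype.card V * E.card *
            min (DigraphAug.numSource E) (DigraphAug.numTarget E)) := by
  -- A round costs at most `540 |V||E|`, and there are at most `k + 1 ≤ 2k` of them, as `k ≥ 1`.
  refine ⟨1080, fun V _ _ E hwc hsc ord => ?_⟩
  have hne : Nonempty V := by
    by_contra hne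
    exact hsc fun u => absurd ⟨u⟩ hne
  obtain ⟨v⟩ := hne
  have : Nonempty V := ⟨v⟩
  have h0 : E ∪ (DigraphAug.run E ord 0).added = E := Finset.union_empty E
  have hs := DigraphAug.card_srcs_le hwc hsc
  have ht := DigraphAug.card_tgts_le hwc hsc
  have hsV : (DigraphAug.srcs E).card ≤ Fintype.card V := Finset.card_le_univ _
  have hpos : 1 ≤ min (DigraphAug.srcs E).card (DigraphAug.tgts E).card := by
    obtain ⟨s, hs, -⟩ := DigraphAug.exists_isSrc E v
    obtain ⟨t, ht, -⟩ := DigraphAug.exists_isTgt E v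
    exact le_min (Finset.card_pos.2 ⟨s, DigraphAug.mem_srcs.2 hs⟩)
      (Finset.card_pos.2 ⟨t, DigraphAug.mem_tgts.2 ht⟩)
  obtain ⟨m, hm, htime⟩ := DigraphAug.exists_exited (ord := ord) hwc
    (min (DigraphAug.srcs E).card (DigraphAug.tgts E).card) 0 rfl
    (fun u => by simp [DigraphAug.run, DigraphAug.Net.initial, DigraphAug.Agent.initial])
    (by rw [h0]; exact hsc)
    (by rw [h0]; simpa [DigraphAug.run, DigraphAug.Net.initial] using hsV)
    (by rw [h0])
  refine ⟨⟨m, fun u => (hm u).1⟩, fun n u => ?_⟩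
  refine (DigraphAug.time_le_of_exited hm n u).trans ((htime u).trans ?_)
  have htime0 : (DigraphAug.run E ord 0).time u = 0 := rfl
  rw [htime0, zero_add]
  have hVE := hwc.card_le hsc
  set k := min (DigraphAug.srcs E).card (DigraphAug.tgts E).card with hk
  have hk' : k ≤ min (DigraphAug.numSource E) (DigraphAug.numTarget E) := min_le_min hs ht
  -- The left side is `240 |V|² + 60 |V||E|`, and `|V| ≤ 2|E|`.
  have hcost : DigraphAug.roundCost (Fintype.card V) (E.card + 3 * Fintype.card V) ≤
      540 * (Fintype.card V * E.card) := by
    unfold DigraphAug.roundCost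
    have := Nat.mul_le_mul_left (Fintype.card V) hVE
    calc _ = 240 * (Fintype.card V * Fintype.card V) + 60 * (Fintype.card V * E.card) := by ring
      _ ≤ 240 * (Fintype.card V * (2 * E.card)) + 60 * (Fintype.card V * E.card) := by omega
      _ = _ := by ring
  calc _ ≤ (2 * k) * (540 * (Fintype.card V * E.card)) := Nat.mul_le_mul (by omega) hcost
    _ = 1080 * (Fintype.card V * E.card * k) := by ring
    _ ≤ _ := by gcongr
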